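/- A delta operator is a linear operator $Q:\mathbb{C}[x]\to\mathbb{C}[x]$ that lowers degrees by one (and kills constants) and commutes with all shifts $f(x)\mapsto f(x+a)$, $a\in\mathbb{C}$; it can be written $Q=a_1D+a_2D^2+\cdots$ with $D=\frac{d}{dx}$, $a_1\neq 0$, and it acts by this formula on $\mathbb{C}((x^{-1}))$. It is normalized if $a_1=1$. Let $Q$ be a normalized delta operator, and let $p_n(x),p^*_n(x)\in\mathbb{C}((x^{-1}))$, $n\in\mathbb{Z}$, be the associated sequences: for $n\ge 0$, $p_n$ is the polynomial determined by $p_0=1$, $Qp_n=np_{n-1}$ and $p_n(0)=0$ $(n\geq 1)$; for all $n\in\mathbb{Z}$, $p_{n+1}(x)=x\,p^*_n(x)$ and $Qp^*_n=np^*_{n-1}$ (so $p^*_{-1}=x^{-1}$, which determines the terms with $n<0$). For $N\ge 1$ and $k\in\mathbb{Z}$ put $\lambda=(k,0,\ldots,0)\in\mathbb{Z}^N$ and $$h_k(x_1,\ldots,x_N)=\frac{\det\bigl(p_{\lambda_i+N-i}(x_j)\bigr)_{1\le i,j\le N}}{\det\bigl(p_{N-i}(x_j)\bigr)_{1\le i,j\le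 N}},\qquad h^*_k(x_1,\ldots,x_N)=\frac{\det\bigl(p^*_{\lambda_i+N-i}(x_j)\bigr)_{1\le i,j\le N}}{\det\bigl(p^*_{N-i}(x_j)\bigr)_{1\le i,j\le N}},$$ elements of $\mathbb{C}((x_1^{-1},\ldots,x_N^{-1}))$, the ring of series in the $x_j^{\pm1}$ whose exponents are bounded above in each variable. **Theorem.** For every $N\ge1$ and every $k\in\mathbb{Z}$, \begin{align*} h_k(x_1+u,\ldots,x_N+u)&=\sum_{l\ge0}\binom{N+k-1}{N+l-1}h_l(x_1,\ldots,x_N)\,p_{k-l}(u),\\ h^*_k(x_1+u,\ldots,x_N+u)&=\sum_{l\ge0}\binom{N+k-1}{N+l-1}h^*_l(x_1,\ldots,x_N)\,p_{k-l}(u)\\ &=\sum_{l\ge0}\binom{N+k-1}{N+l-1}h_l(x_1,\ldots,x_N)\,p^*_{k-l}(u). \end{align*} Here $\binom{a}{r}=a(a-1)\cdots(a-r+1)/r!$ for $a\in\mathbb{Z}$, $r\geq 0$, and these are equalities of Laurent series in $u^{-1}$ with coefficients in $\mathbb{C}((x_1^{-1},\ldots,x_N^{-1}))$: on the left each $(x_j+u)^e$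 is expanded in descending powers of $u$, and the sums on the right converge coefficientwise. -/

import Mathlib

open scoped Polynomial

namespace BinomialSchur

noncomputable section

/-! ### Delta operators -/

/-- `Q : ℂ[x] → ℂ[x]` is a delta operator: it reduces degrees by one (constants are killed)
and commutes with every shift `f(x) ↦ f(x + a)`. -/
structure IsDeltaOperator (Q : ℂ[X] →ₗ[ℂ] ℂ[X]) : Prop where
  map_const : ∀ c : ℂ, Q (Polynomial.C c) = 0
  degree_map : ∀ f : ℂ[X], 0 < f.degree → (Q f).degree + 1 = f.degree
  map_shift : ∀ (a : ℂ) (f : ℂ[X]),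
    Q (f.comp (Polynomial.X + Polynomial.C a)) = (Q f).comp (Polynomial.X + Polynomial.C a)

/-- The coefficient `a_j` of `D ^ j` in the expansion `Q = a_1 D + a_2 D ^ 2 + ⋯`:
it is `(Q x ^ j)(0) / j!`. -/
def deltaCoeff (Q : ℂ[X] →ₗ[ℂ] ℂ[X]) (j : ℕ) : ℂ :=
  (Q (Polynomial.X ^ j)).eval 0 / (j.factorial : ℂ)

/-! ### Laurent series in `x⁻¹` -/

/-- The ring `ℂ((x⁻¹))`. The coefficient at `m : ℤ` is the coefficient of `x ^ (-m)`. -/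
abbrev InvLaurent : Type := HahnSeries ℤ ℂ

/-- The element `x` of `ℂ((x⁻¹))`. -/
def xVar : InvLaurent := HahnSeries.single (-1) 1

/-- The element `x⁻¹` of `ℂ((x⁻¹))`. -/
def xInv : InvLaurent := HahnSeries.single 1 1

/-- The derivation `D = d/dx` of `ℂ((x⁻¹))`; in terms of `y = x⁻¹` it is `- y ^ 2 d/dy`. -/
def ddx (f : InvLaurent) : InvLaurent :=
  -(HahnSeries.single 2 1 * LaurentSeries.derivative ℂ f)

/-- The coefficient of `x ^ (-m)` in `D f` is `1 - m` times that of `x ^ (1 - m)` in `f`. -/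
theorem coeff_ddx (f : InvLaurent) (m : ℤ) :
    (ddx f).coeff m = (1 - m : ℂ) * f.coeff (m - 1) := by
  have h : (HahnSeries.single (2 : ℤ) (1 : ℂ) * LaurentSeries.derivative ℂ f).coeff m
      = (LaurentSeries.derivative ℂ f).coeff (m - 2) := by
    have := HahnSeries.coeff_single_mul_add (r := (1 : ℂ))
      (x := LaurentSeries.derivative ℂ f) (a := m - 2) (b := (2 : ℤ))
    simpa using this
  rw [ddx, HahnSeries.coeff_neg, h, LaurentSeries.derivative_apply,
    LaurentSeries.hasseDeriv_coeff]
  have e : m - 2 + ((1 : ℕ) : ℤ) = m - 1 := by push_cast; ring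
  rw [e, Ring.choose_one_right, zsmul_eq_mul]
  push_cast
  ring

theorem coeff_ddx_iterate_ne_zero (f : InvLaurent) (j : ℕ) :
    ∀ m : ℤ, (ddx^[j] f).coeff m ≠ 0 → f.coeff (m - j) ≠ 0 := by
  induction j with
  | zero => intro m h; simpa using h
  | succ j ih =>
    intro m h
    rw [Function.iterate_succ_apply', coeff_ddx] at h
    have h' := ih (m - 1) (right_ne_zero_of_mul h)
    have e : m - ((j + 1 : ℕ) : ℤ) = m - 1 - (j : ℤ) := by push_cast; ring
    rwa [e]

theorem bddBelow_support (f : InvLaurent) : ∃ b : ℤ, ∀ m, f.coeff m ≠ 0 → b ≤ m := by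
  by_cases h : f.support.Nonempty
  · exact ⟨f.isPWO_support.isWF.min h, fun m hm => Set.IsWF.min_le _ h hm⟩
  · exact ⟨0, fun m hm => (h ⟨m, hm⟩).elim⟩

/-- The summable family `a_j D ^ j f`, `j ≥ 0`, in `ℂ((x⁻¹))`. -/
def deltaFamily (Q : ℂ[X] →ₗ[ℂ] ℂ[X]) (f : InvLaurent) : HahnSeries.SummableFamily ℤ ℂ ℕ where
  toFun j := deltaCoeff Q j • ddx^[j] f
  isPWO_iUnion_support' := by
    obtain ⟨b, hb⟩ := bddBelow_support f
    refine (BddBelow.isWF ⟨b, ?_⟩).isPWO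
    intro m hm
    obtain ⟨j, hj⟩ := Set.mem_iUnion.1 hm
    have h1 : (ddx^[j] f).coeff m ≠ 0 := right_ne_zero_of_mul
      (show deltaCoeff Q j * (ddx^[j] f).coeff m ≠ 0 from hj)
    have := hb _ (coeff_ddx_iterate_ne_zero f j m h1)
    omega
  finite_co_support' m := by
    obtain ⟨b, hb⟩ := bddBelow_support f
    refine (Set.finite_Iic (m - b).toNat).subset fun j hj => ?_
    have h1 : (ddx^[j] f).coeff m ≠ 0 := right_ne_zero_of_mul
      (show deltaCoeff Q j * (ddx^[j] f).coeff m ≠ 0 from hj)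
    have := hb _ (coeff_ddx_iterate_ne_zero f j m h1)
    simp only [Set.mem_Iic]
    omega

/-- The action of `Q = a_1 D + a_2 D ^ 2 + ⋯` on `ℂ((x⁻¹))`. -/
def deltaExt (Q : ℂ[X] →ₗ[ℂ] ℂ[X]) (f : InvLaurent) : InvLaurent := (deltaFamily Q f).hsum

/-! ### The sequences `p_n` and `p*_n`, `n ∈ ℤ` -/

/-- The basic polynomials `p_n`, `n ≥ 0`, of a delta operator `Q`: `p_0 = 1`, and `p_{n+1}` is the
unique polynomial with `Q p_{n+1} = (n + 1) p_n` and `p_{n+1}(0) = 0`. -/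
def basicPoly (Q : ℂ[X] →ₗ[ℂ] ℂ[X]) : ℕ → ℂ[X]
  | 0 => 1
  | n + 1 => Classical.epsilon fun f : ℂ[X] =>
      Q f = ((n : ℂ) + 1) • basicPoly Q n ∧ f.eval 0 = 0

/-- The series `p*_{-1-m}`, `m ≥ 0`: `p*_{-1} = x⁻¹`, and the remaining ones are determined
downwards by `Q p*_{-1-m} = -(m + 1) p*_{-2-m}`. -/
def negStar (Q : ℂ[X] →ₗ[ℂ] ℂ[X]) : ℕ → InvLaurent
  | 0 => xInv
  | m + 1 => (-((m : ℂ) + 1)⁻¹) • deltaExt Q (negStar Q m)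

/-- `p_n ∈ ℂ((x⁻¹))` for `n ∈ ℤ`: the basic polynomial for `n ≥ 0`, and `x p*_{n-1}` for
`n < 0`. -/
def pSeq (Q : ℂ[X] →ₗ[ℂ] ℂ[X]) : ℤ → InvLaurent
  | Int.ofNat n => Polynomial.aeval xVar (basicPoly Q n)
  | Int.negSucc m => xVar * negStar Q (m + 1)

/-- `p*_n = x⁻¹ p_{n+1} ∈ ℂ((x⁻¹))` for `n ∈ ℤ`. -/
def pStarSeq (Q : ℂ[X] →ₗ[ℂ] ℂ[X]) (n : ℤ) : InvLaurent := xInv * pSeq Q (n + 1)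

/-! ### Schur type functions -/

/-- The ring `ℂ((x_1⁻¹, …, x_N⁻¹))` of series `∑ a_k x ^ k` whose exponents are bounded above in
each coordinate. The coefficient at `m : Fin N → ℤ` is that of `∏ x_j ^ (-m_j)`; the sets of
exponents that are partially well ordered for the product order are exactly those bounded below in
each coordinate. -/
def MvInvLaurent (N : ℕ) : Type := HahnSeries (Fin N → ℤ) ℂ

instance (N : ℕ) : CommRing (MvInvLaurent N) :=
  inferInstanceAs (CommRing (HahnSeries (Fin N → ℤ) ℂ))

/-- A series as an element of the underlying Hahn series ring. -/
def toHahn {N : ℕ} : MvInvLaurent N ≃+* HahnSeries (Fin N → ℤ) ℂ :=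
  RingEquiv.refl (HahnSeries (Fin N → ℤ) ℂ)

/-- The constants of `ℂ((x_1⁻¹, …, x_N⁻¹))`. -/
def constX {N : ℕ} : ℂ →+* MvInvLaurent N :=
  (toHahn (N := N)).symm.toRingHom.comp HahnSeries.C

/-- The embedding `ℂ((x⁻¹)) → ℂ((x_1⁻¹, …, x_N⁻¹))`, `f(x) ↦ f(x_j)`. -/
def inVar {N : ℕ} (j : Fin N) : InvLaurent →+* MvInvLaurent N :=
  (toHahn (N := N)).symm.toRingHom.comp <|
    HahnSeries.embDomainRingHom (AddMonoidHom.single (fun _ : Fin N => ℤ) j)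
      (fun a b h => Pi.single_injective (M := fun _ : Fin N => ℤ) j h)
      (fun a b => by simp [Pi.single_le_single])

/-- The determinant `det (q_{λ_i + N - i}(x_j))`, `1 ≤ i, j ≤ N`
(the row index `i : Fin N` starts at `0`). -/
def altDet {N : ℕ} (q : ℤ → InvLaurent) (lam : Fin N → ℤ) : MvInvLaurent N :=
  Matrix.det (Matrix.of fun i j : Fin N => inVar j (q (lam i + (N : ℤ) - 1 - (i : ℕ))))

/-- The quotient `det (q_{λ_i + N - i}(x_j)) / det (q_{N - i}(x_j))` in
`ℂ((x_1⁻¹, …, x_N⁻¹))`: the element whose product with the denominator is the numerator. -/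
def schur {N : ℕ} (q : ℤ → InvLaurent) (lam : Fin N → ℤ) : MvInvLaurent N :=
  Classical.epsilon fun s : MvInvLaurent N => s * altDet q 0 = altDet q lam

/-- The index `(k) = (k, 0, …, 0) ∈ ℤ ^ N`. -/
def rowIndex (N : ℕ) (k : ℤ) : Fin N → ℤ := fun i => if (i : ℕ) = 0 then k else 0

/-- `h_k(x_1, …, x_N)`, for `k ∈ ℤ`. -/
def hFun (Q : ℂ[X] →ₗ[ℂ] ℂ[X]) (N : ℕ) (k : ℤ) : MvInvLaurent N :=
  schur (pSeq Q) (rowIndex N k)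

/-- `h*_k(x_1, …, x_N)`, for `k ∈ ℤ`. -/
def hStarFun (Q : ℂ[X] →ₗ[ℂ] ℂ[X]) (N : ℕ) (k : ℤ) : MvInvLaurent N :=
  schur (pStarSeq Q) (rowIndex N k)

/-! ### The substitution `x_j ↦ x_j + u` -/

/-- Laurent series in `u⁻¹` over `ℂ((x_1⁻¹, …, x_N⁻¹))`; this contains `ℂ[x_1, …, x_N]((u⁻¹))`.
The coefficient at `d : ℤ` is the coefficient of `u ^ (-d)`. -/
abbrev ULaurent (N : ℕ) : Type := HahnSeries ℤ (MvInvLaurent N)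

/-- `f(x_1, …, x_N)` as a series in `u⁻¹` that is constant in `u`. -/
def constU {N : ℕ} (f : MvInvLaurent N) : ULaurent N := HahnSeries.C f

/-- The expansion `(x_j + u) ^ e = ∑_{r ≥ 0} (e choose r) x_j ^ r u ^ (e - r)`, for `e ∈ ℤ`. -/
def addUPow {N : ℕ} (j : Fin N) (e : ℤ) : ULaurent N :=
  HahnSeries.single (-e) 1 *
    HahnSeries.ofPowerSeries ℤ (MvInvLaurent N)
      (PowerSeries.mk fun r : ℕ => ((Ring.choose e r : ℤ) : MvInvLaurent N) * inVar j xVar ^ r)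

theorem coeff_addUPow_ne_zero {N : ℕ} (j : Fin N) (e d : ℤ) (h : (addUPow j e).coeff d ≠ 0) :
    -e ≤ d := by
  by_contra hlt
  apply h
  have h1 := HahnSeries.coeff_single_mul_add (r := (1 : MvInvLaurent N))
    (x := HahnSeries.ofPowerSeries ℤ (MvInvLaurent N)
      (PowerSeries.mk fun r : ℕ => ((Ring.choose e r : ℤ) : MvInvLaurent N) * inVar j xVar ^ r))
    (a := d + e) (b := -e)
  rw [addUPow]
  rw [show d + e + -e = d by ring, one_mul] at h1
  rw [h1, HahnSeries.ofPowerSeries_apply]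
  apply HahnSeries.embDomain_of_notMem_range
  rintro ⟨n, hn⟩
  have hn' : ((n : ℕ) : ℤ) = d + e := hn
  omega

theorem coeff_prod_ne_zero {R ι : Type*} [CommRing R] (s : Finset ι) (g : ι → HahnSeries ℤ R)
    (b : ι → ℤ) (hg : ∀ i, ∀ d, (g i).coeff d ≠ 0 → b i ≤ d) :
    ∀ d, (∏ i ∈ s, g i).coeff d ≠ 0 → ∑ i ∈ s, b i ≤ d := by
  classical
  induction s using Finset.induction_on with
  | empty =>
    intro d h
    simp only [Finset.prod_empty, HahnSeries.coeff_one, Finset.sum_empty] at h ⊢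
    split_ifs at h with h0
    · exact h0.ge
    · exact (h rfl).elim
  | insert i s hi ih =>
    intro d h
    rw [Finset.prod_insert hi, HahnSeries.coeff_mul] at h
    obtain ⟨x, hx, hne⟩ := Finset.exists_ne_zero_of_sum_ne_zero h
    obtain ⟨hx1, hx2, hx3⟩ := Finset.mem_antidiagonal.1 hx
    have h1 := hg i _ hx1
    have h2 := ih _ hx2
    rw [Finset.sum_insert hi]
    omega

/-- The expansion of the monomial `∏ (x_j + u) ^ (-m_j)` in descending powers of `u`. -/
def addUMonomial {N : ℕ} (m : Fin N → ℤ) : ULaurent N := ∏ j, addUPow j (-m j)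

theorem coeff_addUMonomial_ne_zero {N : ℕ} (m : Fin N → ℤ) (d : ℤ)
    (h : (addUMonomial m).coeff d ≠ 0) : ∑ j, m j ≤ d :=
  coeff_prod_ne_zero Finset.univ _ m
    (fun j d hd => by simpa using coeff_addUPow_ne_zero j (-m j) d hd) d h

theorem coeff_constU_C_mul {N : ℕ} (c : ℂ) (g : ULaurent N) (d : ℤ) :
    (constU (constX c) * g).coeff d = constX c * g.coeff d :=
  HahnSeries.coeff_single_zero_mul

theorem bddBelow_support_mv {N : ℕ} (f : MvInvLaurent N) :
    ∃ b : Fin N → ℤ, ∀ m, (toHahn f).coeff m ≠ 0 → b ≤ m := by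
  have key : ∀ j : Fin N, ∃ b : ℤ, ∀ m, (toHahn f).coeff m ≠ 0 → b ≤ m j := by
    intro j
    have hp : ((fun m : Fin N → ℤ => m j) '' (toHahn f).support).IsPWO :=
      (toHahn f).isPWO_support.image_of_monotone (Function.monotone_eval j)
    by_cases h : ((fun m : Fin N → ℤ => m j) '' (toHahn f).support).Nonempty
    · exact ⟨hp.isWF.min h, fun m hm => Set.IsWF.min_le _ h ⟨m, hm, rfl⟩⟩
    · exact ⟨0, fun m hm => (h ⟨_, m, hm, rfl⟩).elim⟩
  choose b hb using key
  exact ⟨b, fun m hm j => hb j m hm⟩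

/-- The summable family `f_m ∏ (x_j + u) ^ (-m_j)`, where `f = ∑ f_m ∏ x_j ^ (-m_j)`. -/
def shiftFamily {N : ℕ} (f : MvInvLaurent N) :
    HahnSeries.SummableFamily ℤ (MvInvLaurent N) (Fin N → ℤ) where
  toFun m := constU (constX ((toHahn f).coeff m)) * addUMonomial m
  isPWO_iUnion_support' := by
    obtain ⟨b, hb⟩ := bddBelow_support_mv f
    refine (BddBelow.isWF ⟨∑ j, b j, ?_⟩).isPWO
    intro d hd
    obtain ⟨m, hm⟩ := Set.mem_iUnion.1 hd
    have hm' : (constU (constX ((toHahn f).coeff m)) * addUMonomial m).coeff d ≠ 0 := hm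
    rw [coeff_constU_C_mul] at hm'
    have hf : (toHahn f).coeff m ≠ 0 := fun h0 => hm' (by rw [h0, map_zero, zero_mul])
    have hg : (addUMonomial m).coeff d ≠ 0 := right_ne_zero_of_mul hm'
    exact (Finset.sum_le_sum fun j _ => hb m hf j).trans
      (coeff_addUMonomial_ne_zero m d hg)
  finite_co_support' d := by
    obtain ⟨b, hb⟩ := bddBelow_support_mv f
    refine (Set.finite_Icc b fun j => d - ∑ i ∈ Finset.univ.erase j, b i).subset fun m hm => ?_
    have hm' : (constU (constX ((toHahn f).coeff m)) * addUMonomial m).coeff d ≠ 0 := hm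
    rw [coeff_constU_C_mul] at hm'
    have hf : (toHahn f).coeff m ≠ 0 := fun h0 => hm' (by rw [h0, map_zero, zero_mul])
    have hg : (addUMonomial m).coeff d ≠ 0 := right_ne_zero_of_mul hm'
    have h1 := hb m hf
    have h2 := coeff_addUMonomial_ne_zero m d hg
    refine ⟨h1, fun j => ?_⟩
    rw [← Finset.add_sum_erase _ _ (Finset.mem_univ j)] at h2
    have h3 : ∑ i ∈ Finset.univ.erase j, b i ≤ ∑ i ∈ Finset.univ.erase j, m i :=
      Finset.sum_le_sum fun i _ => h1 i
    show m j ≤ d - ∑ i ∈ Finset.univ.erase j, b i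
    omega

/-- The substitution `f(x_1, …, x_N) ↦ f(x_1 + u, …, x_N + u)`, expanded in descending powers
of `u`. -/
def addU {N : ℕ} (f : MvInvLaurent N) : ULaurent N := (shiftFamily f).hsum

/-- The embedding `ℂ((x⁻¹)) → ℂ((x_1⁻¹, …, x_N⁻¹))((u⁻¹))`, `f(x) ↦ f(u)`. -/
def inU {N : ℕ} (f : InvLaurent) : ULaurent N :=
  f.map (constX : ℂ →+* MvInvLaurent N)

/-- The family `f` of Laurent series is summable (the orders are bounded below and for each
exponent only finitely many members have a nonzero coefficient there) and its sum is `s`. -/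
def HasLaurentSum {ι R : Type*} [AddCommMonoid R] (f : ι → HahnSeries ℤ R)
    (s : HahnSeries ℤ R) : Prop :=
  ∃ F : HahnSeries.SummableFamily ℤ R ι, (∀ i, F i = f i) ∧ F.hsum = s

end

end BinomialSchur

open BinomialSchur

namespace BinomialSchur

noncomputable section

section

/-! ### Power series in `D` acting on `ℂ((x⁻¹))` -/

/-! Write `Q = q(D)`. Taylor's formula `f(x + u) = ∑ x^r / r! · (D^r f)(u)` holds for every `f` in
`ℂ((x⁻¹))`. The generating function `e^{xt} = ∑ p_l(x) q(t)^l / l!` (`IsDeltaOperator.sum_pSeq`)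
regroups it as `f(x + u) = ∑ p_l(x) (Q^l f)(u) / l!`. Differentiating the generating function in `t`
and dividing by `x` gives `e^{xt} = ∑ p*_l(x) q(t)^l q'(t) / l!` (`IsDeltaOperator.sum_pStarSeq`),
hence `f(x + u) = ∑ p*_l(x) (Q^l q'(D) f)(u) / l!`. Now `Q^l / l!` sends `p_m` to `binom(m, l)
p_{m-l}` and likewise for `p*`, while `q'(D) p*_m = p_m`; the latter rests on the Pincherle identity
`[φ(D), x] = φ'(D)` (`psAct_xVar_mul`). This is the theorem for `N = 1`.

For `N = n + 1`, all rows of the determinants but the first hold monic polynomials of degrees `n -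
1, …, 0`, which may be replaced by powers. Up to a common sign the numerator is an alternant with
one free column `f(x_j)`, where `f` is `p_{n+k}` or `p*_{n+k}`, and the denominator is an alternant
`V` which is a Vandermonde determinant up to sign. The differences `x_i - x_j` do not feel the shift
by `u`, so neither do `V` and the minors, and the shift acts on the free column alone. Inserting the
one-variable expansion there, the terms of index below `n` vanish by degree, and the term of index
`n + l` gives `V h_l` or `V h*_l` times `binom(n + k, n + l)`. Cancelling the regular element `V`
finishes the proof (`hasLaurentSum_of_expansion`).

That the quotients exist, also for negative `k`, follows from Newton interpolation with explicit
divided differences (`altern_inVar`). -/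

theorem succ_mul_choose_succ (a : ℤ) (j : ℕ) :
    ((j : ℤ) + 1) * Ring.choose a (j + 1) = (a - j) * Ring.choose a j := by
  have h1 := Ring.descPochhammer_eq_factorial_smul_choose a (j + 1)
  have h2 := Ring.descPochhammer_eq_factorial_smul_choose a j
  rw [descPochhammer_succ_right, Polynomial.smeval_mul, h2] at h1
  simp only [Polynomial.smeval_sub, Polynomial.smeval_X, Polynomial.smeval_natCast, npow_one,
    npow_zero, Nat.factorial_succ, nsmul_eq_mul, mul_one] at h1
  have h3 : ((j.factorial : ℕ) : ℤ) ≠ 0 := by exact_mod_cast j.factorial_ne_zero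
  apply mul_left_cancel₀ h3
  push_cast at h1
  linear_combination -h1

theorem coeff_ddx_iterate (f : InvLaurent) (j : ℕ) (m : ℤ) :
    (ddx^[j] f).coeff m
      = (j.factorial : ℂ) * ((Ring.choose ((j : ℤ) - m) j : ℤ) : ℂ) * f.coeff (m - j) := by
  induction j generalizing m with
  | zero => simp
  | succ j ih =>
    rw [Function.iterate_succ_apply', coeff_ddx, ih]
    have h := succ_mul_choose_succ (((j + 1 : ℕ) : ℤ) - m) j
    have h' : ((j : ℂ) + 1) * ((Ring.choose (((j + 1 : ℕ) : ℤ) - m) (j + 1) : ℤ) : ℂ)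
        = (1 - m) * ((Ring.choose (((j + 1 : ℕ) : ℤ) - m) j : ℤ) : ℂ) := by
      have := congrArg (Int.cast : ℤ → ℂ) h
      push_cast at this ⊢
      linear_combination this
    have e1 : (j : ℤ) - (m - 1) = ((j + 1 : ℕ) : ℤ) - m := by push_cast; ring
    have e2 : m - 1 - (j : ℤ) = m - ((j + 1 : ℕ) : ℤ) := by push_cast; ring
    rw [e1, e2, Nat.factorial_succ]
    push_cast at h' ⊢
    linear_combination (-(j.factorial : ℂ) * f.coeff (m - (j + 1))) * h'

/-- `b` is a lower bound for the support. -/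
def SuppGE (b : ℤ) (f : InvLaurent) : Prop := ∀ m, f.coeff m ≠ 0 → b ≤ m

theorem SuppGE.coeff_eq_zero {b : ℤ} {f : InvLaurent} (h : SuppGE b f) {m : ℤ} (hm : m < b) :
    f.coeff m = 0 := by
  by_contra h0
  exact absurd (h m h0) (not_le.2 hm)

theorem exists_suppGE (f : InvLaurent) : ∃ b, SuppGE b f := bddBelow_support f

theorem SuppGE.iterate {b : ℤ} {f : InvLaurent} (h : SuppGE b f) (j : ℕ) :
    SuppGE (b + j) (ddx^[j] f) := fun m hm => by
  have := h _ (coeff_ddx_iterate_ne_zero f j m hm)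
  omega

theorem SuppGE.mono {b b' : ℤ} {f : InvLaurent} (h : SuppGE b f) (hb : b' ≤ b) : SuppGE b' f :=
  fun m hm => hb.trans (h m hm)

/-- The summable family `φ_j D ^ j f`. -/
def psFamily (φ : PowerSeries ℂ) (f : InvLaurent) : HahnSeries.SummableFamily ℤ ℂ ℕ where
  toFun j := PowerSeries.coeff j φ • ddx^[j] f
  isPWO_iUnion_support' := by
    obtain ⟨b, hb⟩ := exists_suppGE f
    refine (BddBelow.isWF ⟨b, ?_⟩).isPWO
    intro m hm
    obtain ⟨j, hj⟩ := Set.mem_iUnion.1 hm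
    exact (hb.iterate j).mono (by omega) m (right_ne_zero_of_mul
      (show PowerSeries.coeff j φ * (ddx^[j] f).coeff m ≠ 0 from hj))
  finite_co_support' m := by
    obtain ⟨b, hb⟩ := exists_suppGE f
    refine (Set.finite_Iic (m - b).toNat).subset fun j hj => ?_
    have := (hb.iterate j) m (right_ne_zero_of_mul
      (show PowerSeries.coeff j φ * (ddx^[j] f).coeff m ≠ 0 from hj))
    simp only [Set.mem_Iic]
    omega

/-- The action of `φ(D) = ∑ φ_j D ^ j` on `ℂ((x⁻¹))`. -/
def psAct (φ : PowerSeries ℂ) (f : InvLaurent) : InvLaurent := (psFamily φ f).hsum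

theorem coeff_psAct (φ : PowerSeries ℂ) (f : InvLaurent) (m : ℤ) :
    (psAct φ f).coeff m = ∑ᶠ j, PowerSeries.coeff j φ * (ddx^[j] f).coeff m := by
  rw [psAct, HahnSeries.SummableFamily.coeff_hsum]
  rfl

/-- `D` raises the order in `x⁻¹` by at least one, so only `j < K` can reach the exponent `m`.
Identities for `psAct` thereby become identities of finite sums with one common truncation. -/
theorem SuppGE.coeff_psAct {b : ℤ} {f : InvLaurent} (h : SuppGE b f) (φ : PowerSeries ℂ) (m : ℤ)
    (K : ℕ) (hK : m < b + K) :
    (psAct φ f).coeff m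
      = ∑ j ∈ Finset.range K, PowerSeries.coeff j φ * (ddx^[j] f).coeff m := by
  rw [BinomialSchur.coeff_psAct]
  apply finsum_eq_sum_of_support_subset
  intro j hj
  have := (h.iterate j) m (right_ne_zero_of_mul (Function.mem_support.1 hj))
  simp only [Finset.coe_range, Set.mem_Iio]
  omega

theorem exists_bound (b m : ℤ) : ∃ K : ℕ, m < b + K := ⟨(m - b).toNat + 1, by omega⟩

theorem SuppGE.psAct_of_dvd {b : ℤ} {f : InvLaurent} (h : SuppGE b f) {φ : PowerSeries ℂ} {l : ℕ}
    (hφ : PowerSeries.X ^ l ∣ φ) : SuppGE (b + l) (psAct φ f) := by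
  intro m hm
  by_contra hlt
  apply hm
  obtain ⟨K, hK⟩ := exists_bound b m
  rw [h.coeff_psAct φ m K hK]
  refine Finset.sum_eq_zero fun j _ => ?_
  by_cases hj : j < l
  · rw [PowerSeries.X_pow_dvd_iff.1 hφ j hj, zero_mul]
  · rw [(h.iterate j).coeff_eq_zero (by omega), mul_zero]

theorem SuppGE.psAct {b : ℤ} {f : InvLaurent} (h : SuppGE b f) (φ : PowerSeries ℂ) :
    SuppGE b (psAct φ f) := by
  simpa using h.psAct_of_dvd (φ := φ) (l := 0) (by simp)

theorem ddx_add (f g : InvLaurent) : ddx (f + g) = ddx f + ddx g := by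
  ext m; simp only [coeff_ddx, HahnSeries.coeff_add]; ring

theorem ddx_smul (c : ℂ) (f : InvLaurent) : ddx (c • f) = c • ddx f := by
  ext m; simp only [coeff_ddx, HahnSeries.coeff_smul, smul_eq_mul]; ring

theorem ddx_iterate_add (j : ℕ) (f g : InvLaurent) :
    ddx^[j] (f + g) = ddx^[j] f + ddx^[j] g := by
  ext m; simp only [coeff_ddx_iterate, HahnSeries.coeff_add]; ring

theorem ddx_iterate_smul (j : ℕ) (c : ℂ) (f : InvLaurent) :
    ddx^[j] (c • f) = c • ddx^[j] f := by
  ext m; simp only [coeff_ddx_iterate, HahnSeries.coeff_smul, smul_eq_mul]; ring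

theorem SuppGE.add {b : ℤ} {f g : InvLaurent} (hf : SuppGE b f) (hg : SuppGE b g) :
    SuppGE b (f + g) := fun m hm => by
  by_contra hlt
  apply hm
  rw [HahnSeries.coeff_add, hf.coeff_eq_zero (not_le.1 hlt), hg.coeff_eq_zero (not_le.1 hlt),
    add_zero]

theorem exists_suppGE₂ (f g : InvLaurent) : ∃ b, SuppGE b f ∧ SuppGE b g := by
  obtain ⟨b, hb⟩ := exists_suppGE f
  obtain ⟨c, hc⟩ := exists_suppGE g
  exact ⟨min b c, hb.mono (min_le_left _ _), hc.mono (min_le_right _ _)⟩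

theorem psAct_add (φ : PowerSeries ℂ) (f g : InvLaurent) :
    psAct φ (f + g) = psAct φ f + psAct φ g := by
  ext m
  obtain ⟨b, hf, hg⟩ := exists_suppGE₂ f g
  obtain ⟨K, hK⟩ := exists_bound b m
  rw [HahnSeries.coeff_add, hf.coeff_psAct φ m K hK, hg.coeff_psAct φ m K hK,
    (hf.add hg).coeff_psAct φ m K hK, ← Finset.sum_add_distrib]
  refine Finset.sum_congr rfl fun j _ => ?_
  rw [ddx_iterate_add, HahnSeries.coeff_add, mul_add]

theorem psAct_smul (φ : PowerSeries ℂ) (c : ℂ) (f : InvLaurent) :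
    psAct φ (c • f) = c • psAct φ f := by
  ext m
  obtain ⟨b, hf⟩ := exists_suppGE f
  obtain ⟨K, hK⟩ := exists_bound b m
  have hcf : SuppGE b (c • f) := fun m hm => hf m fun h0 => hm (by simp [h0])
  rw [HahnSeries.coeff_smul, hf.coeff_psAct φ m K hK, hcf.coeff_psAct φ m K hK, smul_eq_mul,
    Finset.mul_sum]
  refine Finset.sum_congr rfl fun j _ => ?_
  rw [ddx_iterate_smul, HahnSeries.coeff_smul, smul_eq_mul]
  ring

theorem psAct_zero_right (φ : PowerSeries ℂ) : psAct φ 0 = 0 := by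
  have := psAct_add φ 0 0
  rw [add_zero] at this
  exact left_eq_add.1 this

theorem smul_psAct (c : ℂ) (φ : PowerSeries ℂ) (f : InvLaurent) :
    psAct (c • φ) f = c • psAct φ f := by
  ext m
  obtain ⟨b, hf⟩ := exists_suppGE f
  obtain ⟨K, hK⟩ := exists_bound b m
  rw [HahnSeries.coeff_smul, hf.coeff_psAct φ m K hK, hf.coeff_psAct _ m K hK, smul_eq_mul,
    Finset.mul_sum]
  refine Finset.sum_congr rfl fun j _ => ?_
  rw [PowerSeries.coeff_smul, smul_eq_mul, mul_assoc]

theorem psAct_one (f : InvLaurent) : psAct 1 f = f := by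
  ext m
  rw [coeff_psAct, finsum_eq_single _ 0]
  · simp
  · intro j hj
    rw [PowerSeries.coeff_one, if_neg hj, zero_mul]

theorem ddx_psAct (φ : PowerSeries ℂ) (f : InvLaurent) :
    ddx (psAct φ f) = psAct φ (ddx f) := by
  ext m
  obtain ⟨b, hf⟩ := exists_suppGE f
  obtain ⟨K, hK⟩ := exists_bound b m
  have h1 : SuppGE b (ddx f) := (hf.iterate 1).mono (by omega)
  rw [coeff_ddx, hf.coeff_psAct φ (m - 1) K (by omega), h1.coeff_psAct φ m K hK, Finset.mul_sum]
  refine Finset.sum_congr rfl fun j _ => ?_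
  rw [← Function.iterate_succ_apply, Function.iterate_succ_apply', coeff_ddx]
  ring

theorem ddx_iterate_psAct (φ : PowerSeries ℂ) (f : InvLaurent) (j : ℕ) :
    ddx^[j] (psAct φ f) = psAct φ (ddx^[j] f) := by
  induction j with
  | zero => rfl
  | succ j ih => rw [Function.iterate_succ_apply', ih, ddx_psAct, Function.iterate_succ_apply']

/-- Compares a Cauchy product with a composite: what the square has beyond the triangle lies past
the truncation. -/
theorem sum_range_antidiagonal {M : Type*} [AddCommMonoid M] (K : ℕ) (F : ℕ → ℕ → M)
    (hF : ∀ i j, K ≤ i + j → F i j = 0) :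
    ∑ n ∈ Finset.range K, ∑ p ∈ Finset.HasAntidiagonal.antidiagonal n, F p.1 p.2
      = ∑ i ∈ Finset.range K, ∑ j ∈ Finset.range K, F i j := by
  rw [← Finset.sum_product', ← Finset.sum_filter_of_ne (p := fun p : ℕ × ℕ => p.1 + p.2 < K)]
  · rw [← Finset.sum_fiberwise_of_maps_to (t := Finset.range K) (g := fun p : ℕ × ℕ => p.1 + p.2)]
    · refine Finset.sum_congr rfl fun n hn => Finset.sum_congr ?_ fun _ _ => rfl
      ext ⟨i, j⟩
      simp only [Finset.mem_range] at hn
      simp only [Finset.HasAntidiagonal.mem_antidiagonal, Finset.mem_filter, Finset.mem_product, Finset.mem_range]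
      omega
    · intro p hp
      simpa using (Finset.mem_filter.1 hp).2
  · intro p _ hp
    by_contra h
    exact hp (hF _ _ (not_lt.1 h))

theorem psAct_mul (φ ψ : PowerSeries ℂ) (f : InvLaurent) :
    psAct (φ * ψ) f = psAct φ (psAct ψ f) := by
  ext m
  obtain ⟨b, hf⟩ := exists_suppGE f
  obtain ⟨K, hK⟩ := exists_bound b m
  rw [hf.coeff_psAct _ m K hK, (hf.psAct ψ).coeff_psAct φ m K hK]
  have h1 : ∀ i ∈ Finset.range K, PowerSeries.coeff i φ * (ddx^[i] (psAct ψ f)).coeff m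
      = ∑ j ∈ Finset.range K,
        PowerSeries.coeff i φ * (PowerSeries.coeff j ψ * (ddx^[i + j] f).coeff m) := by
    intro i _
    rw [ddx_iterate_psAct, ((hf.iterate i).mono (by omega)).coeff_psAct ψ m K hK, Finset.mul_sum]
    refine Finset.sum_congr rfl fun j _ => ?_
    rw [add_comm i j, Function.iterate_add_apply]
  rw [Finset.sum_congr rfl h1, ← sum_range_antidiagonal K fun i j =>
    PowerSeries.coeff i φ * (PowerSeries.coeff j ψ * (ddx^[i + j] f).coeff m)]
  · refine Finset.sum_congr rfl fun n _ => ?_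
    rw [PowerSeries.coeff_mul, Finset.sum_mul]
    refine Finset.sum_congr rfl fun p hp => ?_
    rw [Finset.HasAntidiagonal.mem_antidiagonal.1 hp, mul_assoc]
  · intro i j hij
    rw [(hf.iterate (i + j)).coeff_eq_zero (by push_cast; omega), mul_zero, mul_zero]

theorem psAct_comm (φ ψ : PowerSeries ℂ) (f : InvLaurent) :
    psAct φ (psAct ψ f) = psAct ψ (psAct φ f) := by
  rw [← psAct_mul, mul_comm, psAct_mul]

theorem coeff_xVar_mul (f : InvLaurent) (m : ℤ) : (xVar * f).coeff m = f.coeff (m + 1) := by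
  have := HahnSeries.coeff_single_mul_add (r := (1 : ℂ)) (x := f) (a := m + 1) (b := (-1 : ℤ))
  simpa [xVar] using this

theorem ddx_xVar_mul (f : InvLaurent) : ddx (xVar * f) = xVar * ddx f + f := by
  ext m
  simp only [coeff_ddx, HahnSeries.coeff_add, coeff_xVar_mul, sub_add_cancel, add_sub_cancel_right]
  push_cast
  ring

theorem ddx_iterate_xVar_mul (f : InvLaurent) (j : ℕ) :
    ddx^[j + 1] (xVar * f) = xVar * ddx^[j + 1] f + ((j : ℂ) + 1) • ddx^[j] f := by
  induction j with
  | zero => simp [ddx_xVar_mul]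
  | succ j ih =>
    rw [Function.iterate_succ_apply', ih, ddx_add, ddx_xVar_mul, ddx_smul,
      ← Function.iterate_succ_apply' ddx, ← Function.iterate_succ_apply' ddx]
    push_cast
    module

/-- The Pincherle derivative of `φ(D)` is `φ'(D)`. -/
theorem psAct_xVar_mul (φ : PowerSeries ℂ) (f : InvLaurent) :
    psAct φ (xVar * f) = xVar * psAct φ f + psAct (PowerSeries.derivative ℂ φ) f := by
  ext m
  obtain ⟨b, hf⟩ := exists_suppGE f
  obtain ⟨K, hK⟩ := exists_bound b (m + 1)
  have hx : SuppGE (b - 1) (xVar * f) := fun m hm => by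
    rw [coeff_xVar_mul] at hm
    have := hf _ hm
    omega
  -- Multiplication by `x` lowers the order by one, whence the range `K + 1`. With `j = 0` split
  -- off, the commutator `[D^{j+1}, x] = (j+1) D^j` supplies the `j`-th coefficient of `φ'`.
  rw [HahnSeries.coeff_add, coeff_xVar_mul, hx.coeff_psAct φ m (K + 1) (by push_cast; omega),
    hf.coeff_psAct φ (m + 1) (K + 1) (by push_cast; omega), hf.coeff_psAct _ m K (by omega),
    Finset.sum_range_succ', Finset.sum_range_succ' _ K, add_right_comm, ← Finset.sum_add_distrib]
  congr 1
  · refine Finset.sum_congr rfl fun j _ => ?_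
    rw [ddx_iterate_xVar_mul, HahnSeries.coeff_add, coeff_xVar_mul, HahnSeries.coeff_smul,
      PowerSeries.coeff_derivative, smul_eq_mul]
    ring
  · simp [coeff_xVar_mul]

theorem deltaExt_eq_psAct (Q : ℂ[X] →ₗ[ℂ] ℂ[X]) (f : InvLaurent) :
    deltaExt Q f = psAct (PowerSeries.mk (deltaCoeff Q)) f := by
  ext m
  rw [coeff_psAct, deltaExt, HahnSeries.SummableFamily.coeff_hsum]
  simp only [PowerSeries.coeff_mk]
  rfl

/-! ### Polynomials inside `ℂ((x⁻¹))` -/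

/-- The inclusion `ℂ[x] ⊆ ℂ((x⁻¹))`. -/
def ofPoly : ℂ[X] →+* InvLaurent := (Polynomial.aeval xVar : ℂ[X] →ₐ[ℂ] InvLaurent)

theorem algebraMap_mul_eq_smul (c : ℂ) (f : InvLaurent) :
    algebraMap ℂ InvLaurent c * f = c • f := by
  have h : algebraMap ℂ InvLaurent c = HahnSeries.C c := HahnSeries.ofPowerSeries_C c
  rw [h, HahnSeries.C_mul_eq_smul]

theorem ofPoly_apply (P : ℂ[X]) : ofPoly P = Polynomial.aeval xVar P := rfl

theorem ofPoly_monomial (k : ℕ) (c : ℂ) : ofPoly (Polynomial.monomial k c) = c • xVar ^ k := by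
  rw [ofPoly_apply, Polynomial.aeval_monomial, algebraMap_mul_eq_smul]

theorem ofPoly_smul (c : ℂ) (P : ℂ[X]) : ofPoly (c • P) = c • ofPoly P := by
  rw [← algebraMap_mul_eq_smul, Polynomial.smul_eq_C_mul, map_mul, ofPoly_apply, Polynomial.aeval_C]

theorem ofPoly_X : ofPoly Polynomial.X = xVar := by
  rw [ofPoly_apply, Polynomial.aeval_X]

theorem xVar_pow (n : ℕ) : xVar ^ n = HahnSeries.single (-(n : ℤ)) 1 := by
  rw [xVar, HahnSeries.single_pow]
  simp

theorem xVar_mul_xInv : xVar * xInv = 1 := by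
  rw [xVar, xInv, HahnSeries.single_mul_single]
  simp

theorem coeff_ofPoly_neg (P : ℂ[X]) (n : ℕ) : (ofPoly P).coeff (-(n : ℤ)) = P.coeff n := by
  induction P using Polynomial.induction_on' with
  | add p q hp hq => rw [map_add, HahnSeries.coeff_add, hp, hq, Polynomial.coeff_add]
  | monomial k c =>
    rw [ofPoly_monomial, HahnSeries.coeff_smul, xVar_pow,
      HahnSeries.coeff_single, Polynomial.coeff_monomial]
    simp [eq_comm]

theorem coeff_ofPoly_pos (P : ℂ[X]) (m : ℤ) (hm : 0 < m) : (ofPoly P).coeff m = 0 := by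
  induction P using Polynomial.induction_on' with
  | add p q hp hq => rw [map_add, HahnSeries.coeff_add, hp, hq, add_zero]
  | monomial k c =>
    rw [ofPoly_monomial, HahnSeries.coeff_smul, xVar_pow,
      HahnSeries.coeff_single, if_neg (by omega), smul_zero]

theorem ofPoly_injective : Function.Injective ofPoly := fun P P' h => by
  ext n
  rw [← coeff_ofPoly_neg, h, coeff_ofPoly_neg]

theorem ddx_ofPoly (P : ℂ[X]) : ddx (ofPoly P) = ofPoly (Polynomial.derivative P) := by
  ext m
  rw [coeff_ddx]
  rcases lt_trichotomy m 1 with hm | rfl | hm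
  · obtain ⟨n, rfl⟩ : ∃ n : ℕ, m = -(n : ℤ) := ⟨(-m).toNat, by omega⟩
    rw [coeff_ofPoly_neg, Polynomial.coeff_derivative,
      show -(n : ℤ) - 1 = -((n + 1 : ℕ) : ℤ) by push_cast; ring, coeff_ofPoly_neg]
    push_cast
    ring
  · rw [coeff_ofPoly_pos _ 1 one_pos]
    simp
  · rw [coeff_ofPoly_pos _ _ (by omega), coeff_ofPoly_pos _ _ (by omega), mul_zero]

theorem ddx_iterate_ofPoly (P : ℂ[X]) (j : ℕ) :
    ddx^[j] (ofPoly P) = ofPoly (Polynomial.derivative^[j] P) := by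
  induction j with
  | zero => rfl
  | succ j ih => rw [Function.iterate_succ_apply', ih, ddx_ofPoly, Function.iterate_succ_apply']

/-- The action of `φ(D)` on polynomials. -/
def psPoly (φ : PowerSeries ℂ) (P : ℂ[X]) : ℂ[X] :=
  ∑ j ∈ Finset.range (P.natDegree + 1), PowerSeries.coeff j φ • Polynomial.derivative^[j] P

theorem psAct_ofPoly (φ : PowerSeries ℂ) (P : ℂ[X]) :
    psAct φ (ofPoly P) = ofPoly (psPoly φ P) := by
  ext m
  rw [coeff_psAct, psPoly, map_sum, HahnSeries.coeff_sum,
    finsum_eq_sum_of_support_subset (s := Finset.range (P.natDegree + 1))]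
  · refine Finset.sum_congr rfl fun j _ => ?_
    rw [ddx_iterate_ofPoly, ofPoly_smul, HahnSeries.coeff_smul, smul_eq_mul]
  · intro j hj
    simp only [Finset.coe_range, Set.mem_Iio]
    by_contra hlt
    apply Function.mem_support.1 hj
    rw [ddx_iterate_ofPoly, Polynomial.iterate_derivative_eq_zero (by omega)]
    simp

end

section

/-! ### Delta operators and their basic sequences -/

/-- The symbol `q(t) = ∑ a_j t ^ j` of the operator `Q = q(D)`. -/
def symb (Q : ℂ[X] →ₗ[ℂ] ℂ[X]) : PowerSeries ℂ := PowerSeries.mk (deltaCoeff Q)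

variable {Q : ℂ[X] →ₗ[ℂ] ℂ[X]}

theorem eval_zero_eq_sum (Q : ℂ[X] →ₗ[ℂ] ℂ[X]) (P : ℂ[X]) :
    (Q P).eval 0 = ∑ j ∈ Finset.range (P.natDegree + 1), P.coeff j * (Q (Polynomial.X ^ j)).eval 0 := by
  conv_lhs => rw [P.as_sum_range_C_mul_X_pow]
  rw [map_sum, Polynomial.eval_finsetSum]
  refine Finset.sum_congr rfl fun j _ => ?_
  rw [← Polynomial.smul_eq_C_mul, map_smul, Polynomial.eval_smul, smul_eq_mul]

/-- Shift invariance recovers `Q` from the functional `P ↦ (Q P)(0)`: the value of `Q P` at `a` is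
this functional on the Taylor shift of `P`, whose coefficients are the Hasse derivatives at `a`. -/
theorem IsDeltaOperator.eq_psPoly (hQ : IsDeltaOperator Q) (P : ℂ[X]) :
    Q P = psPoly (symb Q) P := by
  refine Polynomial.funext fun a => ?_
  have h1 : (Q P).eval a = (Q (Polynomial.taylor a P)).eval 0 := by
    rw [Polynomial.taylor_apply, hQ.map_shift]
    simp
  rw [h1, eval_zero_eq_sum, Polynomial.natDegree_taylor, psPoly, Polynomial.eval_finsetSum]
  refine Finset.sum_congr rfl fun j _ => ?_
  have hd : Polynomial.derivative^[j] P = (j.factorial : ℂ) • Polynomial.hasseDeriv j P := by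
    rw [← Polynomial.factorial_smul_hasseDeriv, Nat.cast_smul_eq_nsmul]
    rfl
  have : (j.factorial : ℂ) ≠ 0 := by exact_mod_cast j.factorial_ne_zero
  rw [Polynomial.taylor_coeff, Polynomial.eval_smul, symb, PowerSeries.coeff_mk, deltaCoeff, hd,
    Polynomial.eval_smul, smul_eq_mul, smul_eq_mul]
  field_simp

theorem IsDeltaOperator.ofPoly_map (hQ : IsDeltaOperator Q) (P : ℂ[X]) :
    ofPoly (Q P) = psAct (symb Q) (ofPoly P) := by
  rw [psAct_ofPoly, hQ.eq_psPoly]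

theorem IsDeltaOperator.ofPoly_iterate (hQ : IsDeltaOperator Q) (P : ℂ[X]) (l : ℕ) :
    ofPoly (Q^[l] P) = psAct (symb Q ^ l) (ofPoly P) := by
  induction l with
  | zero => rw [pow_zero, psAct_one]; rfl
  | succ l ih => rw [Function.iterate_succ_apply', hQ.ofPoly_map, ih, ← psAct_mul, pow_succ']

theorem IsDeltaOperator.apply_one (hQ : IsDeltaOperator Q) : Q 1 = 0 := by
  simpa using hQ.map_const 1

theorem IsDeltaOperator.coeff_zero_symb (hQ : IsDeltaOperator Q) :
    PowerSeries.coeff 0 (symb Q) = 0 := by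
  simp [symb, deltaCoeff, hQ.apply_one]

theorem coeff_one_symb (hn : deltaCoeff Q 1 = 1) : PowerSeries.coeff 1 (symb Q) = 1 := by
  rw [symb, PowerSeries.coeff_mk, hn]

theorem IsDeltaOperator.X_dvd_symb (hQ : IsDeltaOperator Q) : PowerSeries.X ∣ symb Q :=
  PowerSeries.X_dvd_iff.2 (by simpa using hQ.coeff_zero_symb)

theorem IsDeltaOperator.X_pow_dvd_symb_pow (hQ : IsDeltaOperator Q) (l : ℕ) :
    PowerSeries.X ^ l ∣ symb Q ^ l := pow_dvd_pow_of_dvd hQ.X_dvd_symb l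

theorem IsDeltaOperator.coeff_symb_pow_self (hQ : IsDeltaOperator Q) (hn : deltaCoeff Q 1 = 1)
    (l : ℕ) : PowerSeries.coeff l (symb Q ^ l) = 1 := by
  obtain ⟨τ, hτ⟩ := hQ.X_dvd_symb
  have h1 : PowerSeries.constantCoeff τ = 1 := by
    have := coeff_one_symb hn
    rw [hτ, show (1 : ℕ) = 0 + 1 from rfl, PowerSeries.coeff_succ_X_mul] at this
    simpa using this
  rw [hτ, mul_pow]
  have := PowerSeries.coeff_X_pow_mul (τ ^ l) l 0
  rw [zero_add] at this
  rw [this]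
  simp [h1]

/-- The derivative `q'(t)`, the symbol of the Pincherle derivative of `Q`. -/
def symb' (Q : ℂ[X] →ₗ[ℂ] ℂ[X]) : PowerSeries ℂ := PowerSeries.derivative ℂ (symb Q)

theorem constantCoeff_symb' (hn : deltaCoeff Q 1 = 1) :
    PowerSeries.constantCoeff (symb' Q) = 1 := by
  rw [← PowerSeries.coeff_zero_eq_constantCoeff_apply, symb', PowerSeries.coeff_derivative,
    zero_add, coeff_one_symb hn]
  simp

/-! ### Existence, expansion and degrees of the basic polynomials -/

theorem exists_derivative_eq (P : ℂ[X]) : ∃ F : ℂ[X], Polynomial.derivative F = P := by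
  induction P using Polynomial.induction_on' with
  | add p q hp hq =>
    obtain ⟨F, hF⟩ := hp
    obtain ⟨G, hG⟩ := hq
    exact ⟨F + G, by rw [map_add, hF, hG]⟩
  | monomial k c =>
    refine ⟨Polynomial.monomial (k + 1) (c / (k + 1)), ?_⟩
    rw [Polynomial.derivative_monomial]
    have : (k : ℂ) + 1 ≠ 0 := by exact_mod_cast k.succ_ne_zero
    simp [this]

theorem IsDeltaOperator.surjective (hQ : IsDeltaOperator Q) (hn : deltaCoeff Q 1 = 1) (P : ℂ[X]) :
    ∃ F, Q F = P := by
  obtain ⟨τ, hτ⟩ := hQ.X_dvd_symb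
  have h1 : PowerSeries.constantCoeff τ = 1 := by
    have := coeff_one_symb hn
    rw [hτ, show (1 : ℕ) = 0 + 1 from rfl, PowerSeries.coeff_succ_X_mul] at this
    simpa using this
  obtain ⟨G, hG⟩ := exists_derivative_eq P
  -- As `q = t τ` with `τ` invertible, applying `τ⁻¹(D)` to an antiderivative of `P` leaves only the
  -- factor `D` of `Q` to act.
  refine ⟨psPoly τ⁻¹ G, ofPoly_injective ?_⟩
  rw [hQ.ofPoly_map, ← psAct_ofPoly, ← psAct_mul, hτ, mul_assoc,
    PowerSeries.mul_inv_cancel _ (by rw [h1]; exact one_ne_zero), mul_one, ← hG, ← ddx_ofPoly]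
  ext m
  rw [coeff_psAct, finsum_eq_single _ 1]
  · simp
  · intro j hj
    rw [PowerSeries.coeff_X, if_neg hj, zero_mul]

/-- A polynomial of positive degree is not killed, since its degree drops by exactly one; the kernel
of `Q` thus contains only constants. -/
theorem IsDeltaOperator.eq_of_map_eq (hQ : IsDeltaOperator Q) {f g : ℂ[X]} (h : Q f = Q g)
    (h0 : f.eval 0 = g.eval 0) : f = g := by
  have hz : Q (f - g) = 0 := by rw [map_sub, h, sub_self]
  have hd : ¬ 0 < (f - g).degree := fun hlt => by
    have := hQ.degree_map _ hlt
    rw [hz, Polynomial.degree_zero, WithBot.bot_add] at this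
    rw [← this] at hlt
    exact absurd hlt (by simp)
  have hc := Polynomial.eq_C_of_degree_le_zero (not_lt.1 hd)
  have : (f - g).coeff 0 = 0 := by
    rw [Polynomial.coeff_zero_eq_eval_zero, Polynomial.eval_sub, h0, sub_self]
  rw [this, Polynomial.C_0] at hc
  exact sub_eq_zero.1 hc

/-- The choice made in `basicPoly` is effective because `Q` is surjective and a preimage may be
corrected by a constant. -/
theorem IsDeltaOperator.basicPoly_spec (hQ : IsDeltaOperator Q) (hn : deltaCoeff Q 1 = 1) (n : ℕ) :
    Q (basicPoly Q (n + 1)) = ((n : ℂ) + 1) • basicPoly Q n ∧ (basicPoly Q (n + 1)).eval 0 = 0 := by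
  rw [basicPoly]
  refine Classical.epsilon_spec (p := fun f : ℂ[X] =>
      Q f = ((n : ℂ) + 1) • basicPoly Q n ∧ f.eval 0 = 0) ?_
  obtain ⟨F, hF⟩ := hQ.surjective hn (((n : ℂ) + 1) • basicPoly Q n)
  refine ⟨F - Polynomial.C (F.eval 0), ?_, by simp⟩
  rw [map_sub, hF, hQ.map_const, sub_zero]

theorem basicPoly_zero : basicPoly Q 0 = 1 := by rw [basicPoly]

theorem IsDeltaOperator.natDegree_map_le (hQ : IsDeltaOperator Q) {d : ℕ} {g : ℂ[X]}
    (hg : g.natDegree ≤ d + 1) : (Q g).natDegree ≤ d := by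
  by_cases h : 0 < g.degree
  · have h1 := hQ.degree_map g h
    have h2 := Polynomial.degree_le_of_natDegree_le hg
    rw [← h1] at h2
    apply Polynomial.natDegree_le_of_degree_le
    by_cases h0 : Q g = 0
    · simp [h0]
    · rw [Polynomial.degree_eq_natDegree h0] at h2 ⊢
      have h3 : (Q g).natDegree + 1 ≤ d + 1 := by exact_mod_cast h2
      exact_mod_cast Nat.le_of_succ_le_succ h3
  · rw [Polynomial.eq_C_of_degree_le_zero (not_lt.1 h), hQ.map_const]
    simp

/-- The expansion of a polynomial in the basic sequence. -/
theorem IsDeltaOperator.expansion (hQ : IsDeltaOperator Q) (hn : deltaCoeff Q 1 = 1) (d : ℕ) :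
    ∀ g : ℂ[X], g.natDegree ≤ d →
      g = ∑ l ∈ Finset.range (d + 1), ((Q^[l] g).eval 0 / (l.factorial : ℂ)) • basicPoly Q l := by
  induction d with
  | zero =>
    intro g hg
    rw [Finset.sum_range_one, basicPoly_zero]
    conv_lhs => rw [Polynomial.eq_C_of_natDegree_le_zero hg]
    simp [Polynomial.coeff_zero_eq_eval_zero, Polynomial.smul_eq_C_mul]
  | succ d ih =>
    intro g hg
    apply hQ.eq_of_map_eq
    · conv_lhs => rw [ih (Q g) (hQ.natDegree_map_le hg)]
      rw [map_sum, Finset.sum_range_succ' _ (d + 1), basicPoly_zero, map_smul, hQ.apply_one, smul_zero,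
        add_zero]
      refine Finset.sum_congr rfl fun l _ => ?_
      rw [map_smul, (hQ.basicPoly_spec hn l).1, smul_smul, Function.iterate_succ_apply,
        Nat.factorial_succ]
      congr 1
      have h1 : (l : ℂ) + 1 ≠ 0 := by exact_mod_cast l.succ_ne_zero
      have h2 : (l.factorial : ℂ) ≠ 0 := by exact_mod_cast l.factorial_ne_zero
      push_cast
      field_simp
    · rw [Polynomial.eval_finsetSum, Finset.sum_range_succ', basicPoly_zero, Finset.sum_eq_zero]
      · simp
      · intro l _
        rw [Polynomial.eval_smul, (hQ.basicPoly_spec hn l).2, smul_zero]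

/-- For `j < r` the derivative `D^j x^r` vanishes at `0`, so evaluation at `0` sees only the `r`-th
coefficient of the symbol. -/
theorem IsDeltaOperator.iterate_X_pow (hQ : IsDeltaOperator Q) (l r : ℕ) :
    (Q^[l] (Polynomial.X ^ r)).eval 0 = (r.factorial : ℂ) * PowerSeries.coeff r (symb Q ^ l) := by
  have h : Q^[l] (Polynomial.X ^ r) = psPoly (symb Q ^ l) (Polynomial.X ^ r) :=
    ofPoly_injective (by rw [hQ.ofPoly_iterate, psAct_ofPoly])
  rw [h, psPoly, Polynomial.natDegree_X_pow, Polynomial.eval_finsetSum,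
    Finset.sum_eq_single_of_mem r (by simp)]
  · rw [Polynomial.iterate_derivative_X_pow_eq_smul]
    simp [Nat.descFactorial_self, mul_comm]
  · intro j hj hjr
    have hlt : j < r := by
      have := Finset.mem_range.1 hj
      omega
    rw [Polynomial.iterate_derivative_X_pow_eq_smul]
    simp [Nat.sub_ne_zero_of_lt hlt]

theorem IsDeltaOperator.X_pow_expansion (hQ : IsDeltaOperator Q) (hn : deltaCoeff Q 1 = 1) (r : ℕ) :
    (Polynomial.X : ℂ[X]) ^ r = ∑ l ∈ Finset.range (r + 1),
      ((r.factorial : ℂ) * PowerSeries.coeff r (symb Q ^ l) / (l.factorial : ℂ)) • basicPoly Q l := by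
  conv_lhs => rw [hQ.expansion hn r (Polynomial.X ^ r) (by simp)]
  simp only [hQ.iterate_X_pow]

/-- By normalization `p_n` occurs in the expansion of `x^n` with coefficient `1`, so it is `x^n`
minus a combination of the lower `p_l`, whose degrees are known inductively. -/
theorem IsDeltaOperator.basicPoly_monic (hQ : IsDeltaOperator Q) (hn : deltaCoeff Q 1 = 1) (n : ℕ) :
    (basicPoly Q n).Monic ∧ (basicPoly Q n).natDegree = n := by
  induction n using Nat.strong_induction_on with
  | _ n ih =>
    have h := hQ.X_pow_expansion hn n
    have hf : (n.factorial : ℂ) ≠ 0 := by exact_mod_cast n.factorial_ne_zero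
    rw [Finset.sum_range_succ, hQ.coeff_symb_pow_self hn, mul_one, div_self hf, one_smul] at h
    have hd : (∑ l ∈ Finset.range n, ((n.factorial : ℂ) * PowerSeries.coeff n (symb Q ^ l) /
        (l.factorial : ℂ)) • basicPoly Q l).degree < n := by
      refine (Polynomial.degree_sum_le _ _).trans_lt ?_
      refine (Finset.sup_lt_iff (WithBot.bot_lt_coe n)).2 fun l hl => ?_
      have hl' := Finset.mem_range.1 hl
      refine (Polynomial.degree_smul_le _ _).trans_lt ?_
      rw [Polynomial.degree_eq_natDegree (ih l hl').1.ne_zero, (ih l hl').2]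
      exact Nat.cast_lt.2 hl'
    have h2 : basicPoly Q n = Polynomial.X ^ n - ∑ l ∈ Finset.range n,
        ((n.factorial : ℂ) * PowerSeries.coeff n (symb Q ^ l) / (l.factorial : ℂ)) • basicPoly Q l := by
      rw [h, add_sub_cancel_left]
    rw [h2]
    refine ⟨Polynomial.monic_X_pow_sub (by simpa using hd), ?_⟩
    apply Polynomial.natDegree_eq_of_degree_eq_some
    rw [Polynomial.degree_sub_eq_left_of_degree_lt (by simpa using hd), Polynomial.degree_X_pow]

/-! ### The sequences `p_n` and `p*_n` for all `n ∈ ℤ` -/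

theorem pSeq_natCast (Q : ℂ[X] →ₗ[ℂ] ℂ[X]) (n : ℕ) : pSeq Q n = ofPoly (basicPoly Q n) := rfl

theorem xInv_mul_xVar_mul (f : InvLaurent) : xInv * (xVar * f) = f := by
  rw [← mul_assoc, mul_comm xInv, xVar_mul_xInv, one_mul]

theorem pSeq_negSucc (Q : ℂ[X] →ₗ[ℂ] ℂ[X]) (m : ℕ) :
    pSeq Q (Int.negSucc m) = xVar * negStar Q (m + 1) := rfl

theorem pStarSeq_negSucc (Q : ℂ[X] →ₗ[ℂ] ℂ[X]) (m : ℕ) :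
    pStarSeq Q (Int.negSucc m) = negStar Q m := by
  rw [pStarSeq]
  cases m with
  | zero =>
    rw [show Int.negSucc 0 + 1 = ((0 : ℕ) : ℤ) from rfl, pSeq_natCast, basicPoly_zero, map_one,
      mul_one, negStar]
  | succ m =>
    rw [show Int.negSucc (m + 1) + 1 = Int.negSucc m from rfl, pSeq_negSucc, xInv_mul_xVar_mul]

theorem psAct_symb_negStar (Q : ℂ[X] →ₗ[ℂ] ℂ[X]) (m : ℕ) :
    psAct (symb Q) (negStar Q m) = (-((m : ℂ) + 1)) • negStar Q (m + 1) := by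
  have h : (m : ℂ) + 1 ≠ 0 := by exact_mod_cast m.succ_ne_zero
  rw [negStar, deltaExt_eq_psAct, smul_smul, neg_mul_neg, mul_inv_cancel₀ h, one_smul]
  rfl

theorem IsDeltaOperator.psAct_symb_one (hQ : IsDeltaOperator Q) : psAct (symb Q) 1 = 0 := by
  rw [← map_one ofPoly, ← hQ.ofPoly_map, hQ.apply_one, map_zero]

theorem zero_smul_InvLaurent (f : InvLaurent) : (0 : ℂ) • f = 0 := zero_smul ℂ f

theorem mul_smul_InvLaurent (c : ℂ) (f g : InvLaurent) : f * c • g = c • (f * g) := by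
  rw [← HahnSeries.C_mul_eq_smul, ← HahnSeries.C_mul_eq_smul, mul_left_comm]

/-- The case `n < 0` of `q'(D) p*_n = p_n`. It starts from `0 = Q(x · x⁻¹) = x Q x⁻¹ + q'(D) x⁻¹`.
Applying `Q` to the identity for `m` and commuting it past `x` leaves `m + 2` times the identity for
`m + 1`. -/
theorem IsDeltaOperator.psAct_symb'_negStar (hQ : IsDeltaOperator Q) (m : ℕ) :
    psAct (symb' Q) (negStar Q m) = xVar * negStar Q (m + 1) := by
  induction m with
  | zero =>
    have h := psAct_xVar_mul (symb Q) xInv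
    have h1 := psAct_symb_negStar Q 0
    rw [show negStar Q 0 = xInv by rw [negStar]] at h1 ⊢
    rw [xVar_mul_xInv, hQ.psAct_symb_one, h1, mul_smul_InvLaurent] at h
    rw [symb', eq_neg_of_add_eq_zero_right h.symm]
    push_cast
    module
  | succ m ih =>
    have h := congrArg (psAct (symb Q)) ih
    rw [psAct_comm, psAct_symb_negStar, psAct_smul, psAct_xVar_mul, psAct_symb_negStar,
      mul_smul_InvLaurent] at h
    have hm : (m : ℂ) + 2 ≠ 0 := by exact_mod_cast (m + 1).succ_ne_zero
    change _ = _ + psAct (symb' Q) _ at h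
    have h2 : ((m : ℂ) + 2) • psAct (symb' Q) (negStar Q (m + 1))
        = ((m : ℂ) + 2) • (xVar * negStar Q (m + 1 + 1)) := by
      push_cast at h
      linear_combination (norm := module) -h
    exact smul_right_injective _ hm h2

/-- Both sides vanish at `0`, and they have the same image under `Q`: the commutator `[Q, x] =
q'(D)` cancels `q'(D)⁻¹`, and induction handles the remaining term. Consequently `p*_n = q'(D)⁻¹
p_n` for `n ≥ 0`. -/
theorem IsDeltaOperator.basicPoly_succ_eq (hQ : IsDeltaOperator Q) (hn : deltaCoeff Q 1 = 1)
    (n : ℕ) : basicPoly Q (n + 1) = Polynomial.X * psPoly (symb' Q)⁻¹ (basicPoly Q n) := by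
  have hinv : symb' Q * (symb' Q)⁻¹ = 1 :=
    PowerSeries.mul_inv_cancel _ (by rw [constantCoeff_symb' hn]; exact one_ne_zero)
  have key : ∀ n, psAct (symb Q) (xVar * psAct (symb' Q)⁻¹ (ofPoly (basicPoly Q n)))
      = xVar * psAct (symb' Q)⁻¹ (psAct (symb Q) (ofPoly (basicPoly Q n)))
        + ofPoly (basicPoly Q n) := by
    intro n
    rw [psAct_xVar_mul, psAct_comm]
    congr 1
    change psAct (symb' Q) _ = _
    rw [← psAct_mul, hinv, psAct_one]
  induction n with
  | zero =>
    apply hQ.eq_of_map_eq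
    · apply ofPoly_injective
      rw [hQ.ofPoly_map (Polynomial.X * _), map_mul, ofPoly_X, ← psAct_ofPoly, key,
        (hQ.basicPoly_spec hn 0).1, basicPoly_zero, map_one, hQ.psAct_symb_one, psAct_zero_right,
        mul_zero, zero_add]
      simp
    · rw [(hQ.basicPoly_spec hn _).2]; simp
  | succ n ih =>
    apply hQ.eq_of_map_eq
    · apply ofPoly_injective
      rw [hQ.ofPoly_map (Polynomial.X * _), map_mul, ofPoly_X, ← psAct_ofPoly, key,
        (hQ.basicPoly_spec hn (n + 1)).1, ← hQ.ofPoly_map, (hQ.basicPoly_spec hn n).1, ofPoly_smul,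
        ofPoly_smul, psAct_smul, mul_smul_InvLaurent, psAct_ofPoly, ← ofPoly_X, ← map_mul, ← ih]
      push_cast
      module
    · rw [(hQ.basicPoly_spec hn _).2]; simp

theorem IsDeltaOperator.pStarSeq_natCast (hQ : IsDeltaOperator Q) (hn : deltaCoeff Q 1 = 1)
    (n : ℕ) : pStarSeq Q n = psAct (symb' Q)⁻¹ (ofPoly (basicPoly Q n)) := by
  rw [pStarSeq, show (n : ℤ) + 1 = ((n + 1 : ℕ) : ℤ) by push_cast; rfl, pSeq_natCast,
    hQ.basicPoly_succ_eq hn, map_mul, ofPoly_X, xInv_mul_xVar_mul, psAct_ofPoly]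

/-- The link between the two sequences: `q'(D)` commutes with `Q`, so the recursion for `p_n`
follows from that for `p*_n`, and the factor `q'` in the starred generating function turns `p*` into
`p`. -/
theorem IsDeltaOperator.psAct_symb'_pStarSeq (hQ : IsDeltaOperator Q) (hn : deltaCoeff Q 1 = 1)
    (n : ℤ) : psAct (symb' Q) (pStarSeq Q n) = pSeq Q n := by
  cases n with
  | ofNat n =>
    rw [Int.ofNat_eq_natCast, hQ.pStarSeq_natCast hn, ← psAct_mul, PowerSeries.mul_inv_cancel _
      (by rw [constantCoeff_symb' hn]; exact one_ne_zero), psAct_one, pSeq_natCast]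
  | negSucc m => rw [pStarSeq_negSucc, hQ.psAct_symb'_negStar, pSeq_negSucc]

theorem IsDeltaOperator.psAct_symb_pStarSeq (hQ : IsDeltaOperator Q) (hn : deltaCoeff Q 1 = 1)
    (n : ℤ) : psAct (symb Q) (pStarSeq Q n) = (n : ℂ) • pStarSeq Q (n - 1) := by
  cases n with
  | ofNat n =>
    cases n with
    | zero =>
      rw [Int.ofNat_eq_natCast, hQ.pStarSeq_natCast hn, psAct_comm, basicPoly_zero, map_one,
        hQ.psAct_symb_one, psAct_zero_right, Nat.cast_zero, Int.cast_zero, zero_smul_InvLaurent]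
    | succ n =>
      rw [Int.ofNat_eq_natCast, hQ.pStarSeq_natCast hn, psAct_comm, ← hQ.ofPoly_map,
        (hQ.basicPoly_spec hn n).1, ofPoly_smul, psAct_smul, ← hQ.pStarSeq_natCast hn]
      push_cast
      rw [add_sub_cancel_right]
  | negSucc m =>
    rw [pStarSeq_negSucc, psAct_symb_negStar, show Int.negSucc m - 1 = Int.negSucc (m + 1) from rfl,
      pStarSeq_negSucc, Int.cast_negSucc]
    push_cast
    rfl

theorem IsDeltaOperator.psAct_symb_pSeq (hQ : IsDeltaOperator Q) (hn : deltaCoeff Q 1 = 1)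
    (n : ℤ) : psAct (symb Q) (pSeq Q n) = (n : ℂ) • pSeq Q (n - 1) := by
  rw [← hQ.psAct_symb'_pStarSeq hn, psAct_comm, hQ.psAct_symb_pStarSeq hn, psAct_smul,
    hQ.psAct_symb'_pStarSeq hn]

/-- Iterating `Q a_n = n a_{n-1}`. -/
theorem psAct_symb_pow {a : ℤ → InvLaurent}
    (ha : ∀ n : ℤ, psAct (symb Q) (a n) = (n : ℂ) • a (n - 1)) (l : ℕ) (n : ℤ) :
    psAct ((l.factorial : ℂ)⁻¹ • symb Q ^ l) (a n) = ((Ring.choose n l : ℤ) : ℂ) • a (n - l) := by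
  rw [smul_psAct, inv_smul_eq_iff₀ (by exact_mod_cast l.factorial_ne_zero), smul_smul]
  induction l with
  | zero => simp [psAct_one]
  | succ l ih =>
    rw [pow_succ', psAct_mul, ih, psAct_smul, ha, smul_smul,
      show n - (l : ℤ) - 1 = n - ((l + 1 : ℕ) : ℤ) by push_cast; ring]
    congr 1
    have := congrArg (Int.cast : ℤ → ℂ) (succ_mul_choose_succ n l)
    rw [Nat.factorial_succ]
    push_cast at this ⊢
    linear_combination (-(l.factorial : ℂ)) * this

/-- `x ^ r / r! = ∑ p_l(x) / l! [t ^ r] q(t) ^ l`. -/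
theorem IsDeltaOperator.sum_pSeq (hQ : IsDeltaOperator Q) (hn : deltaCoeff Q 1 = 1) (r : ℕ) :
    ∑ l ∈ Finset.range (r + 1),
      PowerSeries.coeff r ((l.factorial : ℂ)⁻¹ • symb Q ^ l) • pSeq Q l
      = (r.factorial : ℂ)⁻¹ • xVar ^ r := by
  have hr : (r.factorial : ℂ) ≠ 0 := by exact_mod_cast r.factorial_ne_zero
  rw [← ofPoly_X, ← map_pow, hQ.X_pow_expansion hn r, map_sum, Finset.smul_sum]
  refine Finset.sum_congr rfl fun l _ => ?_
  rw [ofPoly_smul, smul_smul, pSeq_natCast, PowerSeries.coeff_smul, smul_eq_mul]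
  congr 1
  field_simp

/-- `x ^ r / r! = ∑ p*_l(x) / l! [t ^ r] q(t) ^ l q'(t)`. -/
theorem IsDeltaOperator.sum_pStarSeq (hQ : IsDeltaOperator Q) (hn : deltaCoeff Q 1 = 1) (r : ℕ) :
    ∑ l ∈ Finset.range (r + 1),
      PowerSeries.coeff r ((l.factorial : ℂ)⁻¹ • (symb Q ^ l * symb' Q)) • pStarSeq Q l
      = (r.factorial : ℂ)⁻¹ • xVar ^ r := by
  -- The coefficient of `t^{r+1}` in the unstarred identity, multiplied by `(r + 1) / x`, is the
  -- coefficient of `t^r` in its `t`-derivative divided by `x`. The term `l = 0` drops out since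
  -- `q^0` is constant.
  have h := hQ.sum_pSeq hn (r + 1)
  rw [Finset.sum_range_succ'] at h
  have h0 : PowerSeries.coeff (r + 1) (((0 : ℕ).factorial : ℂ)⁻¹ • symb Q ^ 0) = 0 := by
    simp [PowerSeries.coeff_one]
  rw [h0, zero_smul_InvLaurent, add_zero] at h
  have hr1 : (r : ℂ) + 1 ≠ 0 := by exact_mod_cast r.succ_ne_zero
  have hr : (r.factorial : ℂ) ≠ 0 := by exact_mod_cast r.factorial_ne_zero
  have h2 := congrArg (fun f => ((r : ℂ) + 1) • (xInv * f)) h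
  simp only [Finset.mul_sum, Finset.smul_sum, mul_smul_InvLaurent, smul_smul] at h2
  rw [pow_succ', xInv_mul_xVar_mul, Nat.factorial_succ] at h2
  convert h2 using 2 with l hl
  · rw [pStarSeq]
    push_cast
    congr 1
    have hl1 : (l : ℂ) + 1 ≠ 0 := by exact_mod_cast l.succ_ne_zero
    have hl : (l.factorial : ℂ) ≠ 0 := by exact_mod_cast l.factorial_ne_zero
    have hd : PowerSeries.derivative ℂ (symb Q ^ (l + 1))
        = ((l : ℂ) + 1) • (symb Q ^ l * symb' Q) := by
      rw [Derivation.leibniz_pow, symb', add_tsub_cancel_right, ← Nat.cast_smul_eq_nsmul ℂ, smul_eq_mul]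
      push_cast
      rfl
    have hc := PowerSeries.coeff_derivative (R := ℂ) (symb Q ^ (l + 1)) r
    rw [hd] at hc
    simp only [PowerSeries.coeff_smul, smul_eq_mul, Nat.factorial_succ] at hc ⊢
    push_cast
    field_simp
    linear_combination hc
  · push_cast
    field_simp

end

section

/-! ### Alternants with one free column -/

section Alternant

variable {A : Type*} [CommRing A] {n : ℕ}

/-- The determinant with first column `w` and remaining columns `v ^ 0, …, v ^ (n - 1)`, expanded
along the first column. -/
def altern (v w : Fin (n + 1) → A) : A :=
  ∑ j : Fin (n + 1), (-1) ^ (j : ℕ) * w j * (Matrix.vandermonde (v ∘ j.succAbove)).det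

theorem altern_eq_det (v w : Fin (n + 1) → A) :
    altern v w = Matrix.det (Matrix.of fun i : Fin (n + 1) =>
      (Fin.cons (w i) fun j : Fin n => v i ^ (j : ℕ) : Fin (n + 1) → A)) := by
  rw [Matrix.det_succ_column_zero, altern]
  refine Finset.sum_congr rfl fun j _ => ?_
  congr 2

theorem altern_add (v w w' : Fin (n + 1) → A) :
    altern v (fun j => w j + w' j) = altern v w + altern v w' := by
  simp only [altern, ← Finset.sum_add_distrib]
  exact Finset.sum_congr rfl fun j _ => by ring

theorem altern_mul (v w : Fin (n + 1) → A) (c : A) :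
    altern v (fun j => c * w j) = c * altern v w := by
  simp only [altern, Finset.mul_sum]
  exact Finset.sum_congr rfl fun j _ => by ring

theorem altern_sum {ι : Type*} (s : Finset ι) (v : Fin (n + 1) → A) (w : ι → Fin (n + 1) → A) :
    altern v (fun j => ∑ i ∈ s, w i j) = ∑ i ∈ s, altern v (w i) := by
  simp only [altern, Finset.mul_sum, Finset.sum_mul]
  rw [Finset.sum_comm]

theorem altern_pow (v : Fin (n + 1) → A) {k : ℕ} (hk : k < n) :
    altern v (fun j => v j ^ k) = 0 := by
  rw [altern_eq_det]
  refine Matrix.det_zero_of_column_eq (i := 0) (j := (⟨k, hk⟩ : Fin n).succ)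
    (Fin.succ_ne_zero _).symm fun i => ?_
  rw [Matrix.of_apply, Fin.cons_zero, Matrix.of_apply, Fin.cons_succ]

theorem altern_eval_of_degree_lt (v : Fin (n + 1) → A) (P : A[X]) (hP : P.degree < n) :
    altern v (fun j => P.eval (v j)) = 0 := by
  simp only [Polynomial.eval_eq_sum, Polynomial.sum_def]
  rw [altern_sum]
  refine Finset.sum_eq_zero fun i hi => ?_
  rw [altern_mul, altern_pow v, mul_zero]
  exact_mod_cast (Polynomial.le_degree_of_mem_supp i hi).trans_lt hP

theorem altern_eval_of_monic (v : Fin (n + 1) → A) (P : A[X]) (hP : P.Monic)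
    (hd : P.natDegree = n) :
    altern v (fun j => P.eval (v j)) = altern v (fun j => v j ^ n) := by
  have h := altern_eval_of_degree_lt v P.eraseLead ?_
  · have h2 : ∀ j, P.eval (v j) = P.eraseLead.eval (v j) + v j ^ n := fun j => by
      conv_lhs => rw [← P.eraseLead_add_C_mul_X_pow, hP.leadingCoeff, hd]
      simp
    simp only [h2]
    rw [altern_add, h, zero_add]
  · nontriviality A
    refine (Polynomial.degree_eraseLead_lt hP.ne_zero).trans_eq ?_
    rw [Polynomial.degree_eq_natDegree hP.ne_zero, hd]

/-- Moving the last column to the front costs the sign. Through this the alternant inherits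
regularity and shift invariance from the product formula for the Vandermonde determinant. -/
theorem det_vandermonde_eq_altern (v : Fin (n + 1) → A) :
    (Matrix.vandermonde v).det = (-1) ^ n * altern v (fun j => v j ^ n) := by
  rw [Matrix.det_succ_column _ (Fin.last n), altern, Finset.mul_sum]
  refine Finset.sum_congr rfl fun j _ => ?_
  have h : (Matrix.vandermonde v).submatrix j.succAbove (Fin.last n).succAbove
      = Matrix.vandermonde (v ∘ j.succAbove) := by
    ext a b
    simp [Matrix.vandermonde_apply]
  rw [h, Matrix.vandermonde_apply, Fin.val_last, pow_add]
  ring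

end Alternant

/-! ### The ring `ℂ((x_1⁻¹, …, x_N⁻¹))` -/

variable {N : ℕ}

instance (N : ℕ) : Nontrivial (MvInvLaurent N) :=
  inferInstanceAs (Nontrivial (HahnSeries (Fin N → ℤ) ℂ))

/-- The coefficient of `∏ x_j ^ (-m_j)`. -/
def mvCoeff (f : MvInvLaurent N) (m : Fin N → ℤ) : ℂ := (toHahn f).coeff m

theorem mv_ext {f g : MvInvLaurent N} (h : ∀ m, mvCoeff f m = mvCoeff g m) : f = g :=
  toHahn.injective (HahnSeries.ext (funext h))

theorem mvCoeff_sub (f g : MvInvLaurent N) (m : Fin N → ℤ) :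
    mvCoeff (f - g) m = mvCoeff f m - mvCoeff g m := by
  rw [mvCoeff, map_sub, HahnSeries.coeff_sub]; rfl

theorem mvCoeff_zero (m : Fin N → ℤ) : mvCoeff (0 : MvInvLaurent N) m = 0 := by
  rw [mvCoeff, map_zero, HahnSeries.coeff_zero]

/-- The element `x_j`. -/
def xj (j : Fin N) : MvInvLaurent N := inVar j xVar

theorem toHahn_xj (j : Fin N) : toHahn (xj j) = HahnSeries.single (Pi.single j (-1)) 1 :=
  HahnSeries.embDomain_single

theorem mvCoeff_xj_mul (j : Fin N) (f : MvInvLaurent N) (m : Fin N → ℤ) :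
    mvCoeff (xj j * f) m = mvCoeff f (m + Pi.single j 1) := by
  rw [mvCoeff, map_mul, toHahn_xj]
  have := HahnSeries.coeff_single_mul_add (r := (1 : ℂ)) (x := toHahn f)
    (a := m + Pi.single j 1) (b := Pi.single j (-1))
  rw [one_mul, add_assoc, ← Pi.single_add, add_neg_cancel, Pi.single_zero, add_zero] at this
  exact this

theorem mvCoeff_inVar_single (j : Fin N) (f : InvLaurent) (e : ℤ) :
    mvCoeff (inVar j f) (Pi.single j e) = f.coeff e :=
  HahnSeries.embDomain_coeff (f := ⟨⟨fun e : ℤ => (Pi.single j e : Fin N → ℤ),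
    Pi.single_injective (M := fun _ : Fin N => ℤ) j⟩, by simp [Pi.single_le_single]⟩)

theorem mvCoeff_inVar_of_ne (j : Fin N) (f : InvLaurent) (m : Fin N → ℤ)
    (hm : m ≠ Pi.single j (m j)) : mvCoeff (inVar j f) m = 0 := by
  refine HahnSeries.embDomain_of_notMem_range ?_
  rintro ⟨e, he⟩
  have he' : (Pi.single j e : Fin N → ℤ) = m := he
  apply hm
  rw [← he', Pi.single_eq_same]

theorem inVar_smul (j : Fin N) (c : ℂ) (f : InvLaurent) :
    inVar j (c • f) = constX c * inVar j f := by
  rw [← HahnSeries.C_mul_eq_smul, map_mul]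
  congr 1
  exact HahnSeries.embDomainRingHom_C

theorem inVar_ofPoly (j : Fin N) (P : ℂ[X]) :
    inVar j (ofPoly P) = (P.map constX).eval (xj j) := by
  induction P using Polynomial.induction_on' with
  | add p q hp hq => rw [map_add, map_add, hp, hq, Polynomial.map_add, Polynomial.eval_add]
  | monomial k c =>
    rw [ofPoly_monomial, inVar_smul, map_pow, Polynomial.map_monomial, Polynomial.eval_monomial]
    rfl

/-- Dickson's lemma for `ℕ^N`, translated by `b`. -/
theorem isPWO_of_bddBelow {s : Set (Fin N → ℤ)} (b : Fin N → ℤ) (hb : ∀ m ∈ s, b ≤ m) :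
    s.IsPWO := by
  have h := (Set.isPWO_of_wellQuasiOrderedLE (Set.univ : Set (Fin N → ℕ))).image_of_monotone
    (f := fun a : Fin N → ℕ => fun i => b i + (a i : ℤ)) (fun a a' h i => add_le_add_right (Nat.cast_le.2 (h i)) _)
  refine h.mono fun m hm => ⟨fun i => (m i - b i).toNat, trivial, funext fun i => ?_⟩
  have : b i ≤ m i := hb m hm i
  change b i + ((m i - b i).toNat : ℤ) = m i
  omega

theorem mvCoeff_bddBelow (f : MvInvLaurent N) :
    ∃ b : Fin N → ℤ, ∀ m, mvCoeff f m ≠ 0 → b ≤ m := bddBelow_support_mv f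

/-- `x_i - x_j` is not a zero divisor for `i ≠ j`. -/
theorem eq_zero_of_sub_mul_eq_zero {i j : Fin N} (hij : i ≠ j) {f : MvInvLaurent N}
    (h : (xj i - xj j) * f = 0) : f = 0 := by
  obtain ⟨b, hb⟩ := mvCoeff_bddBelow f
  have hs : ∀ m : Fin N → ℤ, mvCoeff f (m + Pi.single i 1) = mvCoeff f (m + Pi.single j 1) := fun m => by
    rw [← mvCoeff_xj_mul, ← mvCoeff_xj_mul, ← sub_eq_zero, ← mvCoeff_sub, ← sub_mul, h,
      mvCoeff_zero]
  -- Coefficients of `f` are constant in the direction `e_i - e_j`. If one at `m` is nonzero, then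
  -- `m_j - b_j + 1` such steps bring the `j`-th coordinate to `b_j - 1`, outside the support.
  have hs' : ∀ (t : ℕ) (m : Fin N → ℤ),
      mvCoeff f m = mvCoeff f (m + Pi.single i (t : ℤ) - Pi.single j (t : ℤ)) := by
    intro t
    induction t with
    | zero => intro m; simp
    | succ t ih =>
      intro m
      rw [ih m]
      have := hs (m + Pi.single i (t : ℤ) - Pi.single j (t : ℤ) - Pi.single j 1)
      rw [sub_add_cancel] at this
      rw [← this]
      congr 1
      push_cast
      rw [Pi.single_add, Pi.single_add]
      abel
  refine mv_ext fun m => ?_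
  rw [mvCoeff_zero]
  by_contra hm
  rw [hs' (m j - b j + 1).toNat] at hm
  have h1 := hb _ hm j
  have h2 := hb m (by rwa [hs' (m j - b j + 1).toNat]) j
  simp only [Pi.add_apply, Pi.sub_apply, Pi.single_eq_same, Pi.single_eq_of_ne hij.symm] at h1
  omega

theorem det_vandermonde_xj_mem : (Matrix.vandermonde (xj (N := N))).det ∈
    nonZeroDivisors (MvInvLaurent N) := by
  rw [Matrix.det_vandermonde]
  refine prod_mem fun i _ => prod_mem fun j hj => ?_
  rw [mem_nonZeroDivisors_iff_right]
  intro f hf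
  rw [mul_comm] at hf
  exact eq_zero_of_sub_mul_eq_zero (Finset.mem_Ioi.1 hj).ne' hf

/-! ### Divided differences -/

/-- The coefficients of the divided difference of `f` at the nodes `x_i`, `i ∈ S`. -/
def divDiffCoeff (S : Finset (Fin N)) (f : InvLaurent) (m : Fin N → ℤ) : ℂ :=
  -- With `s = |S|`, the divided difference of `x^e` is, for `e ≥ 0`, the sum of all monomials of
  -- degree `e - s + 1` with nonnegative exponents. For `e < 0` it is `(-1)^{s-1}` times the sum of
  -- those with all exponents negative. Since exponents are `-m_i`, these are the two indicator
  -- products.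
  (∏ i ∈ Sᶜ, if m i = 0 then 1 else 0) *
    ((∏ i ∈ S, if m i ≤ 0 then 1 else 0) + (-1) ^ (S.card - 1) * ∏ i ∈ S, if 1 ≤ m i then 1 else 0) *
    f.coeff (∑ i, m i - (S.card - 1 : ℕ))

/-- The divided difference of `f` at the nodes `x_i`, `i ∈ S`. -/
def divDiff (S : Finset (Fin N)) (f : InvLaurent) : MvInvLaurent N :=
  toHahn.symm
    { coeff := divDiffCoeff S f
      isPWO_support' := by
        obtain ⟨b, hb⟩ := exists_suppGE f
        refine isPWO_of_bddBelow (fun _ => min b 0) fun m hm => ?_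
        have hm' : divDiffCoeff S f m ≠ 0 := hm
        rw [divDiffCoeff] at hm'
        have h1 := hb _ (right_ne_zero_of_mul hm')
        have h2 := left_ne_zero_of_mul (left_ne_zero_of_mul hm')
        have h3 := right_ne_zero_of_mul (left_ne_zero_of_mul hm')
        have hoff : ∀ i, i ∉ S → m i = 0 := fun i hi => by
          have := Finset.prod_ne_zero_iff.1 h2 i (by simpa using hi)
          by_contra h0
          simp [h0] at this
        have h4 : (∀ i ∈ S, m i ≤ 0) ∨ ∀ i ∈ S, 1 ≤ m i := by
          by_contra! hcon
          obtain ⟨⟨i, hi, hi'⟩, k, hk, hk'⟩ := hcon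
          apply h3
          rw [Finset.prod_eq_zero hi (by simp [hi']), Finset.prod_eq_zero hk (by simp [hk'])]
          simp
        intro i
        rcases h4 with h4 | h4
        · have hle : ∀ i, m i ≤ 0 := fun i => by
            by_cases hi : i ∈ S
            · exact h4 i hi
            · exact (hoff i hi).le
          have h5 : ∑ i, m i ≤ m i := by
            rw [← Finset.add_sum_erase _ _ (Finset.mem_univ i)]
            have := Finset.sum_nonpos fun k (_ : k ∈ Finset.univ.erase i) => hle k
            omega
          have : b ≤ m i := by omega
          exact (min_le_left _ _).trans this
        · refine (min_le_right _ _).trans ?_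
          by_cases hi : i ∈ S
          · exact zero_le_one.trans (h4 i hi)
          · exact (hoff i hi).ge }

theorem mvCoeff_divDiff (S : Finset (Fin N)) (f : InvLaurent) (m : Fin N → ℤ) :
    mvCoeff (divDiff S f) m = divDiffCoeff S f m := rfl

theorem divDiff_singleton (j : Fin N) (f : InvLaurent) : divDiff {j} f = inVar j f := by
  refine mv_ext fun m => ?_
  rw [mvCoeff_divDiff, divDiffCoeff]
  by_cases hm : m = Pi.single j (m j)
  · have h0 : ∀ i, i ≠ j → m i = 0 := fun i hi => by rw [hm, Pi.single_eq_of_ne hi]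
    rw [Finset.prod_eq_one]
    · conv_rhs => rw [hm, mvCoeff_inVar_single]
      rw [Finset.sum_eq_single j (fun i _ hi => h0 i hi) (by simp)]
      simp only [Finset.prod_singleton, Finset.card_singleton]
      split_ifs <;> first | omega | simp
    · intro i hi
      rw [if_pos (h0 i (by simpa using hi))]
  · rw [mvCoeff_inVar_of_ne j f m hm]
    obtain ⟨i, hi⟩ := Function.ne_iff.1 hm
    have hij : i ≠ j := fun h => hi (by rw [h, Pi.single_eq_same])
    rw [Pi.single_eq_of_ne hij] at hi
    rw [Finset.prod_eq_zero (i := i) (by simpa using hij) (if_neg hi), zero_mul, zero_mul]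

/-- Telescoping in a quadrant: multiplication by `x_j - x_k` leaves only the terms in which one of
the two variables is absent. -/
theorem indicator_nonpos (a b : ℤ) :
    (if a + 1 ≤ 0 then (1 : ℂ) else 0) * (if b ≤ 0 then 1 else 0)
      - (if a ≤ 0 then 1 else 0) * (if b + 1 ≤ 0 then 1 else 0)
      = (if b = 0 then 1 else 0) * (if a ≤ 0 then 1 else 0)
        - (if a = 0 then 1 else 0) * (if b ≤ 0 then 1 else 0) := by
  split_ifs <;> first | omega | simp

theorem indicator_pos (a b : ℤ) :
    (if 1 ≤ a then (1 : ℂ) else 0) * (if 1 ≤ b + 1 then 1 else 0)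
      - (if 1 ≤ a + 1 then 1 else 0) * (if 1 ≤ b then 1 else 0)
      = (if b = 0 then 1 else 0) * (if 1 ≤ a then 1 else 0)
        - (if a = 0 then 1 else 0) * (if 1 ≤ b then 1 else 0) := by
  split_ifs <;> first | omega | simp

/-- The recursion that characterizes divided differences. The nodes in `T` and the variables outside
contribute common factors, so only the two-variable identities `indicator_nonpos` and
`indicator_pos` remain. -/
theorem sub_mul_divDiff {T : Finset (Fin N)} {j k : Fin N} (hj : j ∉ T) (hk : k ∉ T)
    (hjk : j ≠ k) (f : InvLaurent) :
    (xj j - xj k) * divDiff (insert j (insert k T)) f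
      = divDiff (insert j T) f - divDiff (insert k T) f := by
  have hj' : j ∉ insert k T := by simp [hj, hjk]
  have hcj : (insert k T)ᶜ = insert j (insert j (insert k T))ᶜ := by
    ext i; by_cases h : i = j <;> simp [h, hjk, hj]
  have hck : (insert j T)ᶜ = insert k (insert j (insert k T))ᶜ := by
    ext i; by_cases h : i = k <;> simp [h, hk, hjk.symm]
  refine mv_ext fun m => ?_
  rw [sub_mul, mvCoeff_sub, mvCoeff_sub, mvCoeff_xj_mul, mvCoeff_xj_mul]
  simp only [mvCoeff_divDiff, divDiffCoeff]
  rw [hcj, hck, Finset.prod_insert (s := (insert j (insert k T))ᶜ) (a := j) (by simp),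
    Finset.prod_insert (s := (insert j (insert k T))ᶜ) (a := k) (by simp),
    Finset.card_insert_of_notMem hj', Finset.card_insert_of_notMem hk,
    Finset.card_insert_of_notMem hj]
  have hsum : ∀ i : Fin N, ∑ a, (m + Pi.single i 1 : Fin N → ℤ) a - ((T.card + 1 + 1 - 1 : ℕ) : ℤ)
      = ∑ a, m a - ((T.card + 1 - 1 : ℕ) : ℤ) := fun i => by
    simp only [Pi.add_apply, Finset.sum_add_distrib, Finset.sum_pi_single', Finset.mem_univ, if_true]
    push_cast [Nat.add_sub_cancel]
    ring
  rw [hsum, hsum]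
  simp only [Finset.prod_insert hj', Finset.prod_insert hk, Finset.prod_insert hj]
  have hcong : ∀ (U : Finset (Fin N)) (i : Fin N), i ∉ U → ∀ p : ℤ → ℂ,
      ∏ a ∈ U, p ((m + Pi.single i 1 : Fin N → ℤ) a) = ∏ a ∈ U, p (m a) := fun U i hi p =>
    Finset.prod_congr rfl fun a ha => by
      have hai : a ≠ i := fun h => hi (h ▸ ha)
      rw [Pi.add_apply, Pi.single_eq_of_ne hai, add_zero]
  have e1 := fun (i : Fin N) (hi : i ∉ T) => hcong T i hi fun z => if z ≤ 0 then 1 else 0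
  have e2 := fun (i : Fin N) (hi : i ∉ T) => hcong T i hi fun z => if 1 ≤ z then 1 else 0
  have e3 := fun (i : Fin N) hi => hcong (insert j (insert k T))ᶜ i hi fun z => if z = 0 then 1 else 0
  rw [e1 j hj, e1 k hk, e2 j hj, e2 k hk, e3 j (by simp), e3 k (by simp)]
  simp only [Pi.add_apply, Pi.single_eq_same, Pi.single_eq_of_ne hjk, Pi.single_eq_of_ne hjk.symm,
    add_zero, Nat.add_sub_cancel]
  generalize f.coeff _ = c
  clear e1 e2 e3 hcong hsum hcj hck
  generalize (∏ a ∈ (insert j (insert k T))ᶜ, if m a = 0 then (1 : ℂ) else 0) = o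
  generalize (∏ a ∈ T, if m a ≤ 0 then (1 : ℂ) else 0) = p
  generalize (∏ a ∈ T, if 1 ≤ m a then (1 : ℂ) else 0) = r
  rw [pow_succ]
  generalize (-1 : ℂ) ^ T.card = e
  linear_combination o * p * c * indicator_nonpos (m j) (m k)
    + o * e * r * c * indicator_pos (m j) (m k)

/-- The indices less than `k`. -/
def initSeg (n k : ℕ) : Finset (Fin n) := Finset.univ.filter fun i => (i : ℕ) < k

theorem mem_initSeg {n k : ℕ} {i : Fin n} : i ∈ initSeg n k ↔ (i : ℕ) < k := by simp [initSeg]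

theorem card_initSeg {n k : ℕ} (hk : k ≤ n) : (initSeg n k).card = k := by
  rw [initSeg, Fin.card_filter_val_lt, min_eq_right hk]

theorem newton_interpolation {n : ℕ} (f : InvLaurent) (k : ℕ) (hk : k ≤ n) :
    ∃ P : (MvInvLaurent (n + 1))[X], P.degree < k ∧ ∀ j : Fin (n + 1),
      inVar j f = P.eval (xj j) + (∏ i ∈ initSeg (n + 1) k, (xj j - xj i)) *
        divDiff (insert j (initSeg (n + 1) k)) f := by
  induction k with
  | zero =>
    refine ⟨0, by simp, fun j => ?_⟩
    have : initSeg (n + 1) 0 = ∅ := by ext i; simp [mem_initSeg]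
    simp [this, divDiff_singleton]
  | succ k ih =>
    obtain ⟨P, hP, h⟩ := ih (by omega)
    have hkn : k < n + 1 := by omega
    have hins : initSeg (n + 1) (k + 1) = insert ⟨k, hkn⟩ (initSeg (n + 1) k) := by
      ext i
      rw [Finset.mem_insert, mem_initSeg, mem_initSeg, Fin.ext_iff]
      simp only
      omega
    have hknot : (⟨k, hkn⟩ : Fin (n + 1)) ∉ initSeg (n + 1) k := by simp [mem_initSeg]
    set K : Fin (n + 1) := ⟨k, hkn⟩
    refine ⟨P + Polynomial.C (divDiff (insert K (initSeg (n + 1) k)) f) *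
      ∏ i ∈ initSeg (n + 1) k, (Polynomial.X - Polynomial.C (xj i)), ?_, fun j => ?_⟩
    · refine (Polynomial.degree_add_le _ _).trans_lt (max_lt (hP.trans ?_) ?_)
      · exact_mod_cast k.lt_succ_self
      · rw [← Polynomial.smul_eq_C_mul]
        refine (Polynomial.degree_smul_le _ _).trans_lt ?_
        rw [Polynomial.degree_prod_of_monic _ _ fun i _ => Polynomial.monic_X_sub_C _]
        simp only [Polynomial.degree_X_sub_C, Finset.sum_const, card_initSeg hkn.le]
        rw [nsmul_one]
        exact_mod_cast k.lt_succ_self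
    · rw [h j, hins, Finset.prod_insert hknot]
      simp only [Polynomial.eval_add, Polynomial.eval_mul, Polynomial.eval_C, Polynomial.eval_prod,
        Polynomial.eval_sub, Polynomial.eval_X]
      -- At an earlier node the inserted index repeats and the remainder is not a true divided
      -- difference, but its product factor vanishes.
      by_cases hj : j ∈ initSeg (n + 1) k
      · rw [Finset.prod_eq_zero hj (sub_self _)]
        ring
      · by_cases hjk : j = K
        · rw [hjk]; ring
        · have := sub_mul_divDiff hj hknot hjk f
          linear_combination (-∏ i ∈ initSeg (n + 1) k, (xj j - xj i)) * this

/-- The alternant kills the interpolating polynomial of degree below `n`; what remains is the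
divided difference times a monic polynomial of degree `n`, which acts like `x^n`. Hence the divided
difference is the quotient, for any Laurent series `f`. -/
theorem altern_inVar {n : ℕ} (f : InvLaurent) :
    altern xj (fun j : Fin (n + 1) => inVar j f)
      = divDiff Finset.univ f * altern xj (fun j : Fin (n + 1) => xj j ^ n) := by
  obtain ⟨P, hP, h⟩ := newton_interpolation (n := n) f n le_rfl
  have hall : ∀ j : Fin (n + 1), inVar j f = P.eval (xj j) + divDiff Finset.univ f *
      (∏ i ∈ initSeg (n + 1) n, (Polynomial.X - Polynomial.C (xj i))).eval (xj j) := fun j => by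
    rw [h j]
    simp only [Polynomial.eval_prod, Polynomial.eval_sub, Polynomial.eval_X, Polynomial.eval_C]
    by_cases hj : j ∈ initSeg (n + 1) n
    · rw [Finset.prod_eq_zero hj (sub_self _)]
      ring
    · have : insert j (initSeg (n + 1) n) = Finset.univ := by
        ext i
        simp only [Finset.mem_insert, mem_initSeg, Finset.mem_univ, iff_true, Fin.ext_iff] at hj ⊢
        omega
      rw [this]
      ring
  have h2 := altern_eval_of_monic xj (∏ i ∈ initSeg (n + 1) n, (Polynomial.X - Polynomial.C (xj i)))
    (Polynomial.monic_prod_of_monic _ _ fun i _ => Polynomial.monic_X_sub_C _) (by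
      rw [Polynomial.natDegree_prod_of_monic _ _ fun i _ => Polynomial.monic_X_sub_C _]
      simp [card_initSeg n.le_succ])
  simp only [hall]
  rw [altern_add, altern_mul, altern_eval_of_degree_lt _ _ hP, zero_add, h2]

/-! ### The quotients of alternants -/

/-- The sequence `q` extends a sequence of monic polynomials `P_0, P_1, …`, `deg P_l = l`. -/
def IsMonicSeq (q : ℤ → InvLaurent) : Prop :=
  ∀ l : ℕ, ∃ P : ℂ[X], P.Monic ∧ P.natDegree = l ∧ q l = ofPoly P

theorem altDet_rowIndex {q : ℤ → InvLaurent} (hq : IsMonicSeq q) (n : ℕ) (k : ℤ) :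
    altDet q (rowIndex (n + 1) k)
      = ((Equiv.Perm.sign (Fin.revPerm : Equiv.Perm (Fin n)) : ℤ) : MvInvLaurent (n + 1)) *
        altern xj (fun j : Fin (n + 1) => inVar j (q (n + k))) := by
  choose P hP using hq
  rw [altDet, Matrix.det_succ_row_zero, altern, Finset.mul_sum]
  refine Finset.sum_congr rfl fun j _ => ?_
  have h := Matrix.det_eval_matrixOfPolynomials_eq_det_vandermonde
    (xj ∘ j.succAbove) (fun i : Fin n => (P i).map constX)
    (fun i => by
      rw [(hP i).1.natDegree_map]; exact (hP i).2.1) (fun i => (hP i).1.map _)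
  -- The rows carry degrees `n - 1, …, 0`, while the columns of a Vandermonde matrix carry `0, …, n
  -- - 1`: a transposition and a row reversal, the latter producing the sign.
  have h2 : (Matrix.of fun i j_1 : Fin (n + 1) => inVar j_1
      (q (rowIndex (n + 1) k i + ((n + 1 : ℕ) : ℤ) - 1 - (i : ℕ)))).submatrix Fin.succ j.succAbove
      = (Matrix.of fun a b : Fin n => ((P b).map constX).eval
          ((xj ∘ j.succAbove) a)).transpose.submatrix Fin.revPerm id := by
    ext a b
    simp only [Matrix.submatrix_apply, Matrix.of_apply, Matrix.transpose_apply, Fin.revPerm_apply,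
      Function.comp, id]
    rw [← inVar_ofPoly, ← (hP _).2.2]
    congr 2
    simp only [rowIndex, Fin.val_succ, Fin.val_rev]
    rw [if_neg (by omega)]
    omega
  rw [h2, Matrix.det_permute, Matrix.det_transpose, ← h]
  have e : rowIndex (n + 1) k 0 + ((n + 1 : ℕ) : ℤ) - 1 - ((0 : Fin (n + 1)) : ℕ) = n + k := by
    simp [rowIndex]; ring
  rw [Matrix.of_apply, e]
  ring

theorem altern_monicSeq {q : ℤ → InvLaurent} (hq : IsMonicSeq q) (n : ℕ) :
    altern xj (fun j : Fin (n + 1) => inVar j (q n)) = altern xj (fun j => xj j ^ n) := by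
  obtain ⟨P, h1, h2, h3⟩ := hq n
  simp only [h3, inVar_ofPoly]
  exact altern_eval_of_monic _ _ (h1.map _) (by rw [h1.natDegree_map, h2])

theorem altern_monicSeq_of_lt {q : ℤ → InvLaurent} (hq : IsMonicSeq q) {n l : ℕ} (hl : l < n) :
    altern xj (fun j : Fin (n + 1) => inVar j (q l)) = 0 := by
  obtain ⟨P, h1, h2, h3⟩ := hq l
  simp only [h3, inVar_ofPoly]
  refine altern_eval_of_degree_lt _ _ (Polynomial.degree_map_le.trans_lt ?_)
  rw [Polynomial.degree_eq_natDegree h1.ne_zero, h2]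
  exact_mod_cast hl

/-- The reversal sign `ε` is common to numerator and denominator and disappears by `ε² = 1`;
`altern_inVar` provides the quotient that the choice in `schur` requires. -/
theorem schur_mul {q : ℤ → InvLaurent} (hq : IsMonicSeq q) (n : ℕ) (k : ℤ) :
    schur q (rowIndex (n + 1) k) * altern xj (fun j : Fin (n + 1) => xj j ^ n)
      = altern xj (fun j : Fin (n + 1) => inVar j (q (n + k))) := by
  set ε := ((Equiv.Perm.sign (Fin.revPerm : Equiv.Perm (Fin n)) : ℤ) : MvInvLaurent (n + 1)) with hε
  have hε2 : ε * ε = 1 := by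
    rw [hε, ← Int.cast_mul, Int.units_coe_mul_self, Int.cast_one]
  have h0 : altDet q 0 = ε * altern xj (fun j : Fin (n + 1) => xj j ^ n) := by
    have : (0 : Fin (n + 1) → ℤ) = rowIndex (n + 1) 0 := by ext i; simp [rowIndex]
    rw [this, altDet_rowIndex hq, add_zero, altern_monicSeq hq]
  have hex : ∃ s : MvInvLaurent (n + 1), s * altDet q 0 = altDet q (rowIndex (n + 1) k) :=
    ⟨divDiff Finset.univ (q (n + k)), by
      rw [h0, altDet_rowIndex hq, altern_inVar, ← hε]; ring⟩
  have h := Classical.epsilon_spec hex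
  change schur q (rowIndex (n + 1) k) * _ = _ at h
  rw [h0, altDet_rowIndex hq, ← hε] at h
  linear_combination ε * h + (altern xj (fun j : Fin (n + 1) => inVar j (q (n + k))) -
    schur q (rowIndex (n + 1) k) * altern xj (fun j : Fin (n + 1) => xj j ^ n)) * hε2

end

section

/-! ### The substitution `x_j ↦ x_j + u` -/

variable {N : ℕ}

theorem coeff_addUPow (j : Fin N) (e : ℤ) (r : ℕ) :
    (addUPow j e).coeff (-e + r) = ((Ring.choose e r : ℤ) : MvInvLaurent N) * xj j ^ r := by
  have h1 := HahnSeries.coeff_single_mul_add (r := (1 : MvInvLaurent N))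
    (x := HahnSeries.ofPowerSeries ℤ (MvInvLaurent N)
      (PowerSeries.mk fun r : ℕ => ((Ring.choose e r : ℤ) : MvInvLaurent N) * inVar j xVar ^ r))
    (a := (r : ℤ)) (b := -e)
  rw [addUPow, add_comm, h1, one_mul, HahnSeries.ofPowerSeries_apply_coeff, PowerSeries.coeff_mk]
  rfl

theorem coeff_addUPow_of_lt (j : Fin N) {e d : ℤ} (h : d < -e) : (addUPow j e).coeff d = 0 := by
  by_contra h0
  exact absurd (coeff_addUPow_ne_zero j e d h0) (not_le.2 h)

theorem coeff_C_add_u_mul (a : MvInvLaurent N) (F : ULaurent N) (d : ℤ) :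
    ((constU a + HahnSeries.single (-1) 1) * F).coeff d = a * F.coeff d + F.coeff (d + 1) := by
  have h := HahnSeries.coeff_single_mul_add (r := (1 : MvInvLaurent N)) (x := F)
    (a := d + 1) (b := (-1 : ℤ))
  rw [add_neg_cancel_right, one_mul] at h
  rw [add_mul, HahnSeries.coeff_add, h, constU]
  congr 1
  exact HahnSeries.coeff_single_zero_mul

/-- Pascal's rule, valid for negative exponents as well. -/
theorem addUPow_add_one (j : Fin N) (e : ℤ) :
    addUPow j (e + 1) = (constU (xj j) + HahnSeries.single (-1) 1) * addUPow j e := by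
  ext d
  rw [coeff_C_add_u_mul]
  by_cases hd : d < -(e + 1)
  · rw [coeff_addUPow_of_lt j hd, coeff_addUPow_of_lt j (by omega), coeff_addUPow_of_lt j (by omega)]
    simp
  · obtain ⟨r, rfl⟩ : ∃ r : ℕ, d = -(e + 1) + r := ⟨(d + (e + 1)).toNat, by omega⟩
    rw [coeff_addUPow, show -(e + 1) + (r : ℤ) + 1 = -e + r by ring, coeff_addUPow]
    cases r with
    | zero =>
      rw [coeff_addUPow_of_lt j (by push_cast; omega)]
      simp
    | succ r =>
      rw [show -(e + 1) + ((r + 1 : ℕ) : ℤ) = -e + r by push_cast; ring, coeff_addUPow,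
        Ring.choose_succ_succ]
      push_cast
      ring

theorem addUPow_zero (j : Fin N) : addUPow j 0 = 1 := by
  ext d
  by_cases hd : d < -0
  · rw [coeff_addUPow_of_lt j hd, HahnSeries.coeff_one, if_neg (by omega)]
  · obtain ⟨r, rfl⟩ : ∃ r : ℕ, d = -0 + r := ⟨d.toNat, by omega⟩
    rw [coeff_addUPow, HahnSeries.coeff_one, Ring.choose_zero_ite]
    by_cases hr : r = 0 <;> simp [hr]

theorem addUMonomial_sub_single (i : Fin N) (m : Fin N → ℤ) :
    addUMonomial (m - Pi.single i 1)
      = (constU (xj i) + HahnSeries.single (-1) 1) * addUMonomial m := by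
  rw [addUMonomial, addUMonomial, ← Finset.mul_prod_erase _ _ (Finset.mem_univ i),
    ← Finset.mul_prod_erase Finset.univ (fun j => addUPow j (-m j)) (Finset.mem_univ i), ← mul_assoc,
    ← addUPow_add_one]
  congr 1
  · congr 1
    rw [Pi.sub_apply, Pi.single_eq_same]
    ring
  · refine Finset.prod_congr rfl fun j hj => ?_
    rw [Pi.sub_apply, Pi.single_eq_of_ne (Finset.ne_of_mem_erase hj), sub_zero]

theorem addUMonomial_single (j : Fin N) (e : ℤ) :
    addUMonomial (Pi.single j e) = addUPow j (-e) := by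
  rw [addUMonomial, Finset.prod_eq_single_of_mem j (Finset.mem_univ j)]
  · rw [Pi.single_eq_same]
  · intro i _ hi
    rw [Pi.single_eq_of_ne hi, neg_zero, addUPow_zero]

theorem shiftFamily_coeff (f : MvInvLaurent N) (d : ℤ) (m : Fin N → ℤ) :
    (shiftFamily f m).coeff d = constX (mvCoeff f m) * (addUMonomial m).coeff d :=
  coeff_constU_C_mul _ _ _

theorem coeff_addU (f : MvInvLaurent N) (d : ℤ) :
    (addU f).coeff d = ∑ᶠ m, constX (mvCoeff f m) * (addUMonomial m).coeff d := by
  rw [addU, HahnSeries.SummableFamily.coeff_hsum]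
  exact finsum_congr fun m => shiftFamily_coeff f d m

theorem finite_support_addU (f : MvInvLaurent N) (d : ℤ) :
    (Function.support fun m => constX (mvCoeff f m) * (addUMonomial m).coeff d).Finite := by
  have h := (shiftFamily f).finite_co_support' d
  refine h.subset fun m hm => ?_
  change (shiftFamily f m).coeff d ≠ 0
  rw [shiftFamily_coeff]
  exact hm

theorem addU_sub (f g : MvInvLaurent N) : addU (f - g) = addU f - addU g := by
  ext d
  rw [HahnSeries.coeff_sub, coeff_addU, coeff_addU, coeff_addU,
    ← finsum_sub_distrib (finite_support_addU f d) (finite_support_addU g d)]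
  refine finsum_congr fun m => ?_
  rw [mvCoeff_sub, map_sub, sub_mul]

/-- The substitution `x_j ↦ x_j + u` as an additive map. -/
def addUHom (N : ℕ) : MvInvLaurent N →+ ULaurent N :=
  AddMonoidHom.ofMapSub addU addU_sub

theorem addUHom_apply (f : MvInvLaurent N) : addUHom N f = addU f := rfl

/-- Reindexing the monomials by `e_i`. The substitution is defined termwise, and this is all of its
multiplicativity that the proof needs. -/
theorem coeff_addU_xj_mul (i : Fin N) (f : MvInvLaurent N) (d : ℤ) :
    (addU (xj i * f)).coeff d = xj i * (addU f).coeff d + (addU f).coeff (d + 1) := by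
  have h1 : (addU (xj i * f)).coeff d
      = ∑ᶠ m, constX (mvCoeff f m) * (addUMonomial (m - Pi.single i 1)).coeff d := by
    rw [coeff_addU]
    refine finsum_eq_of_bijective (Equiv.addRight (Pi.single i 1 : Fin N → ℤ))
      (Equiv.bijective _) fun m => ?_
    rw [mvCoeff_xj_mul, Equiv.coe_addRight, add_sub_cancel_right]
  rw [h1, coeff_addU, coeff_addU,
    mul_finsum' _ _ (finite_support_addU f d), ← finsum_add_distrib
      ((finite_support_addU f d).subset fun m hm => right_ne_zero_of_mul hm)
      (finite_support_addU f (d + 1))]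
  refine finsum_congr fun m => ?_
  rw [addUMonomial_sub_single, coeff_C_add_u_mul]
  ring

/-- Multiplication by `g` commutes with the substitution `x_j ↦ x_j + u`. -/
def IsShiftInvariant (g : MvInvLaurent N) : Prop :=
  ∀ (f : MvInvLaurent N) (d : ℤ), (addU (g * f)).coeff d = g * (addU f).coeff d

/-- The two contributions of `u` cancel. -/
theorem isShiftInvariant_xj_sub_xj (i j : Fin N) : IsShiftInvariant (xj i - xj j) := fun f d => by
  rw [sub_mul, addU_sub, HahnSeries.coeff_sub, coeff_addU_xj_mul, coeff_addU_xj_mul]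
  ring

theorem IsShiftInvariant.mul {g h : MvInvLaurent N} (hg : IsShiftInvariant g)
    (hh : IsShiftInvariant h) : IsShiftInvariant (g * h) := fun f d => by
  rw [mul_assoc, hg, hh, mul_assoc]

theorem isShiftInvariant_one : IsShiftInvariant (1 : MvInvLaurent N) := fun f d => by
  rw [one_mul, one_mul]

theorem isShiftInvariant_neg_one : IsShiftInvariant (-1 : MvInvLaurent N) := fun f d => by
  have h := congrArg (fun F : ULaurent N => F.coeff d) (map_neg (addUHom N) f)
  simp only [HahnSeries.coeff_neg, addUHom_apply] at h
  rw [neg_one_mul, neg_one_mul, h]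

theorem IsShiftInvariant.pow {g : MvInvLaurent N} (hg : IsShiftInvariant g) (k : ℕ) :
    IsShiftInvariant (g ^ k) := by
  induction k with
  | zero => rw [pow_zero]; exact isShiftInvariant_one
  | succ k ih => rw [pow_succ]; exact ih.mul hg

theorem isShiftInvariant_prod {ι : Type*} (s : Finset ι) (g : ι → MvInvLaurent N)
    (hg : ∀ i, IsShiftInvariant (g i)) : IsShiftInvariant (∏ i ∈ s, g i) :=
  Finset.prod_induction _ IsShiftInvariant (fun _ _ => IsShiftInvariant.mul) isShiftInvariant_one
    fun i _ => hg i

theorem isShiftInvariant_det_vandermonde {k : ℕ} (s : Fin k → Fin N) :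
    IsShiftInvariant (Matrix.vandermonde ((xj (N := N)) ∘ s)).det := by
  rw [Matrix.det_vandermonde]
  exact isShiftInvariant_prod _ _ fun i => isShiftInvariant_prod _ _ fun j =>
    isShiftInvariant_xj_sub_xj _ _

theorem isShiftInvariant_altern (n : ℕ) :
    IsShiftInvariant (altern xj (fun j : Fin (n + 1) => xj j ^ n)) := by
  have h : altern xj (fun j : Fin (n + 1) => xj j ^ n)
      = (-1) ^ n * (Matrix.vandermonde (xj (N := n + 1) ∘ id)).det := by
    rw [Function.comp_id, det_vandermonde_eq_altern, ← mul_assoc, ← mul_pow]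
    simp
  rw [h]
  exact (isShiftInvariant_neg_one.pow n).mul (isShiftInvariant_det_vandermonde id)

/-- The minors along the free column are Vandermonde determinants, hence pass through the
substitution unchanged. -/
theorem coeff_addU_altern {n : ℕ} (w : Fin (n + 1) → MvInvLaurent (n + 1)) (d : ℤ) :
    (addU (altern xj w)).coeff d = altern xj (fun j => (addU (w j)).coeff d) := by
  rw [altern, altern, ← addUHom_apply, map_sum, HahnSeries.coeff_sum]
  refine Finset.sum_congr rfl fun j _ => ?_
  rw [addUHom_apply, mul_right_comm,
    (isShiftInvariant_neg_one.pow j).mul (isShiftInvariant_det_vandermonde _)]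
  ring

/-- Taylor expansion: `f(x_j + u) = ∑ x_j ^ r / r! (D ^ r f)(u)`. -/
theorem coeff_addU_inVar (j : Fin N) {f : InvLaurent} {b : ℤ} (hf : SuppGE b f) {d : ℤ} {K : ℕ}
    (hK : d < b + K) :
    (addU (inVar j f)).coeff d = ∑ r ∈ Finset.range K,
      constX ((ddx^[r] f).coeff d) * (constX (r.factorial : ℂ)⁻¹ * xj j ^ r) := by
  classical
  have hinj : Function.Injective fun r : ℕ => (Pi.single j (d - r) : Fin N → ℤ) := fun r r' h => by
    have := Pi.single_injective (M := fun _ : Fin N => ℤ) j h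
    simpa using this
  -- Only powers of `x_j` occur, and `x_j^{r-d}` contributes to `u^{-d}` the term `binom(r - d, r)
  -- x_j^r`. The support bound forces `r < K`.
  rw [coeff_addU, finsum_eq_sum_of_support_subset
    (s := (Finset.range K).image fun r : ℕ => (Pi.single j (d - r) : Fin N → ℤ)),
    Finset.sum_image fun _ _ _ _ h => hinj h]
  · refine Finset.sum_congr rfl fun r _ => ?_
    have hc : (addUPow j (-(d - (r : ℤ)))).coeff d
        = ((Ring.choose ((r : ℤ) - d) r : ℤ) : MvInvLaurent N) * xj j ^ r := by
      have := coeff_addUPow j (-(d - (r : ℤ))) r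
      rw [neg_sub]
      rwa [neg_neg, sub_add_cancel, neg_sub] at this
    have hr : constX (N := N) (r.factorial : ℂ) * constX (r.factorial : ℂ)⁻¹ = 1 := by
      rw [← map_mul, mul_inv_cancel₀ (by exact_mod_cast r.factorial_ne_zero), map_one]
    rw [mvCoeff_inVar_single, addUMonomial_single, hc, coeff_ddx_iterate, map_mul, map_mul,
      map_intCast]
    linear_combination (-(constX (f.coeff (d - r)) *
      (((Ring.choose ((r : ℤ) - d) r : ℤ) : MvInvLaurent N) * xj j ^ r))) * hr
  · intro m hm
    have hm' := Function.mem_support.1 hm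
    have h1 : mvCoeff (inVar j f) m ≠ 0 := fun h0 => hm' (by rw [h0, map_zero, zero_mul])
    have h2 : m = Pi.single j (m j) := by
      by_contra h
      exact h1 (mvCoeff_inVar_of_ne j f m h)
    have h3 := coeff_addUMonomial_ne_zero m d (right_ne_zero_of_mul hm')
    have h4 : ∑ i, m i = m j := by
      rw [Finset.sum_eq_single j (fun i _ hi => by rw [h2, Pi.single_eq_of_ne hi]) (by simp)]
    rw [h2, mvCoeff_inVar_single] at h1
    have h5 := hf _ h1
    rw [Finset.coe_image]
    refine ⟨(d - m j).toNat, by simp only [Finset.coe_range, Set.mem_Iio]; omega, ?_⟩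
    simp only
    conv_rhs => rw [h2]
    congr 1
    omega

end

section

/-! ### The binomial expansions -/

theorem coeff_inU {N : ℕ} (f : InvLaurent) (d : ℤ) :
    (inU (N := N) f).coeff d = constX (f.coeff d) := rfl

theorem coeff_constU_mul {N : ℕ} (a : MvInvLaurent N) (F : ULaurent N) (d : ℤ) :
    (constU a * F).coeff d = a * F.coeff d :=
  HahnSeries.coeff_single_zero_mul

theorem inU_intCast_smul {N : ℕ} (c : ℤ) (f : InvLaurent) :
    inU (N := N) ((c : ℂ) • f) = (c : ULaurent N) * inU f := by
  have h : (c : ULaurent N) = constU (c : MvInvLaurent N) :=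
    (map_intCast (HahnSeries.C : MvInvLaurent N →+* ULaurent N) c).symm
  ext d
  rw [h, coeff_constU_mul, coeff_inU, coeff_inU, HahnSeries.coeff_smul, smul_eq_mul, map_mul,
    map_intCast]

variable {φ : ℕ → PowerSeries ℂ} {g : ℕ → InvLaurent}

/-- If `x ^ r / r! = ∑ g_l(x) [t ^ r] φ_l(t)`, then `f(x + u) = ∑ g_l(x) (φ_l(D) f)(u)`. -/
theorem coeff_addU_inVar_of_expansion (hφ : ∀ l, PowerSeries.X ^ l ∣ φ l)
    (hg : ∀ r : ℕ, ∑ l ∈ Finset.range (r + 1), PowerSeries.coeff r (φ l) • g l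
      = (r.factorial : ℂ)⁻¹ • xVar ^ r)
    {N : ℕ} (j : Fin N) {f : InvLaurent} {b : ℤ} (hf : SuppGE b f) {d : ℤ} {K : ℕ}
    (hK : d < b + K) :
    (addU (inVar j f)).coeff d
      = ∑ l ∈ Finset.range K, constX ((psAct (φ l) f).coeff d) * inVar j (g l) := by
  -- Since `t^l` divides `φ_l`, the sum over `l ≤ r` extends to a range independent of `r`, and the
  -- two summations can be exchanged.
  have h1 : ∀ r ∈ Finset.range K, constX (N := N) (r.factorial : ℂ)⁻¹ * xj j ^ r
      = ∑ l ∈ Finset.range K, constX (PowerSeries.coeff r (φ l)) * inVar j (g l) := by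
    intro r hr
    have h2 := congrArg (inVar j) (hg r)
    rw [inVar_smul, map_pow, map_sum] at h2
    simp only [inVar_smul] at h2
    refine h2.symm.trans (Finset.sum_subset ?_ fun l _ hl => ?_)
    · intro l hl
      simp only [Finset.mem_range] at hl hr ⊢
      omega
    · rw [PowerSeries.X_pow_dvd_iff.1 (hφ l) r (by simpa using hl), map_zero, zero_mul]
  rw [coeff_addU_inVar j hf hK, Finset.sum_congr rfl fun r hr => by rw [h1 r hr, Finset.mul_sum],
    Finset.sum_comm]
  refine Finset.sum_congr rfl fun l _ => ?_
  rw [hf.coeff_psAct (φ l) d K hK, map_sum, Finset.sum_mul]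
  refine Finset.sum_congr rfl fun r _ => ?_
  rw [map_mul]
  ring

/-- The common core of the three identities: each coefficient is compared after multiplication by
the alternant of `x^n`, which is regular and shift invariant. The order of the `l`-th term grows
with `l`, which gives summability. -/
theorem hasLaurentSum_of_expansion (hφ : ∀ l, PowerSeries.X ^ l ∣ φ l)
    (hg : ∀ r : ℕ, ∑ l ∈ Finset.range (r + 1), PowerSeries.coeff r (φ l) • g l
      = (r.factorial : ℂ)⁻¹ • xVar ^ r)
    {n : ℕ} (f : InvLaurent) {s : MvInvLaurent (n + 1)} {t : ℕ → MvInvLaurent (n + 1)}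
    (hs : s * altern xj (fun j : Fin (n + 1) => xj j ^ n) = altern xj (fun j => inVar j f))
    (ht : ∀ l, t l * altern xj (fun j : Fin (n + 1) => xj j ^ n)
      = altern xj (fun j => inVar j (g (n + l))))
    (h0 : ∀ l < n, altern xj (fun j : Fin (n + 1) => inVar j (g l)) = 0) :
    HasLaurentSum (fun l => constU (t l) * inU (psAct (φ (n + l)) f)) (addU s) := by
  obtain ⟨b, hb⟩ := exists_suppGE f
  have hsupp : ∀ (l : ℕ) (d : ℤ), (constU (t l) * inU (psAct (φ (n + l)) f)).coeff d ≠ 0 → b + l ≤ d := by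
    intro l d hd
    rw [coeff_constU_mul, coeff_inU] at hd
    have h1 : (psAct (φ (n + l)) f).coeff d ≠ 0 := fun h => hd (by rw [h, map_zero, mul_zero])
    exact (hb.psAct_of_dvd (hφ (n + l))).mono (by push_cast; omega) d h1
  refine ⟨⟨fun l => constU (t l) * inU (psAct (φ (n + l)) f), ?_, ?_⟩, fun _ => rfl, ?_⟩
  · refine (BddBelow.isWF ⟨b, ?_⟩).isPWO
    intro d hd
    obtain ⟨l, hl⟩ := Set.mem_iUnion.1 hd
    have := hsupp l d hl
    omega
  · intro d
    refine (Set.finite_Iic (d - b).toNat).subset fun l hl => ?_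
    have := hsupp l d hl
    simp only [Set.mem_Iic]
    omega
  · ext d
    obtain ⟨K, hK⟩ := exists_bound b d
    rw [HahnSeries.SummableFamily.coeff_hsum, finsum_eq_sum_of_support_subset
      (s := Finset.range K)]
    swap
    · intro l hl
      have := hsupp l d (Function.mem_support.1 hl)
      simp only [Finset.coe_range, Set.mem_Iio]
      omega
    have hreg : altern xj (fun j : Fin (n + 1) => xj j ^ n) ∈
        nonZeroDivisors (MvInvLaurent (n + 1)) := by
      have := det_vandermonde_xj_mem (N := n + 1)
      rw [det_vandermonde_eq_altern] at this
      exact (mul_mem_nonZeroDivisors.1 this).2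
    apply (mul_cancel_left_mem_nonZeroDivisors hreg).1
    have h1 := isShiftInvariant_altern n s d
    rw [← h1, mul_comm _ s, hs, coeff_addU_altern]
    -- The expansion is cut at `n + K`: its first `n` terms are killed by the alternant, and the
    -- other `K` match the terms of the sum.
    have h2 : ∀ j : Fin (n + 1), (addU (inVar j f)).coeff d = _ := fun j =>
      coeff_addU_inVar_of_expansion hφ hg j hb (d := d) (K := n + K) (by push_cast; omega)
    simp only [h2]
    rw [altern_sum, Finset.sum_range_add]
    simp only [altern_mul]
    rw [Finset.sum_eq_zero (s := Finset.range n)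
      fun l hl => by rw [h0 l (Finset.mem_range.1 hl), mul_zero], zero_add,
      Finset.mul_sum]
    refine Finset.sum_congr rfl fun l _ => ?_
    change _ * (constU (t l) * inU (psAct (φ (n + l)) f)).coeff d = _
    rw [coeff_constU_mul, coeff_inU, ← ht]
    ring

/-! ### Specialization to the sequences of a delta operator -/

variable {Q : ℂ[X] →ₗ[ℂ] ℂ[X]}

theorem IsDeltaOperator.isMonicSeq_pSeq (hQ : IsDeltaOperator Q) (hn : deltaCoeff Q 1 = 1) :
    IsMonicSeq (pSeq Q) := fun l =>
  ⟨basicPoly Q l, (hQ.basicPoly_monic hn l).1, (hQ.basicPoly_monic hn l).2, rfl⟩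

/-- Dividing the monic polynomial `p_{l+1}` by `x` leaves a monic polynomial of degree `l`. -/
theorem IsDeltaOperator.isMonicSeq_pStarSeq (hQ : IsDeltaOperator Q) (hn : deltaCoeff Q 1 = 1) :
    IsMonicSeq (pStarSeq Q) := fun l => by
  have h := hQ.basicPoly_monic hn (l + 1)
  rw [hQ.basicPoly_succ_eq hn] at h
  have h1 := Polynomial.Monic.of_mul_monic_left Polynomial.monic_X h.1
  refine ⟨_, h1, ?_, by rw [hQ.pStarSeq_natCast hn, psAct_ofPoly]⟩
  have h2 := h.2
  rw [Polynomial.natDegree_X_mul h1.ne_zero] at h2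
  omega

theorem X_pow_dvd_smul {ψ : PowerSeries ℂ} {l : ℕ} (c : ℂ) (h : PowerSeries.X ^ l ∣ ψ) :
    PowerSeries.X ^ l ∣ c • ψ := by
  rw [PowerSeries.smul_eq_C_mul]
  exact h.mul_left _

/-- With `N = n + 1` the binomial coefficient is `binom(n + k, n + l)`, exactly the scalar that
`Q^{n+l} / (n+l)!` produces on `a_{n+k}`. -/
theorem term_eq {a : ℤ → InvLaurent}
    (ha : ∀ n : ℤ, psAct (symb Q) (a n) = (n : ℂ) • a (n - 1)) (n : ℕ) (k : ℤ) (l : ℕ)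
    (h : MvInvLaurent (n + 1)) :
    ((Ring.choose (((n + 1 : ℕ) : ℤ) + k - 1) (n + 1 + l - 1) : ℤ) : ULaurent (n + 1)) *
        (constU h * inU (a (k - (l : ℤ))))
      = constU h * inU (psAct (((n + l).factorial : ℂ)⁻¹ • symb Q ^ (n + l)) (a (n + k))) := by
  rw [psAct_symb_pow ha, inU_intCast_smul, show n + 1 + l - 1 = n + l by omega,
    show ((n + 1 : ℕ) : ℤ) + k - 1 = n + k by push_cast; ring,
    show (n : ℤ) + k - ((n + l : ℕ) : ℤ) = k - l by push_cast; ring]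
  ring

end

end

end BinomialSchur

/-! ### The three identities -/

open BinomialSchur
theorem theorem4p3 (Q : Polynomial ℂ →ₗ[ℂ] Polynomial ℂ) (hQ : IsDeltaOperator Q)
    (hnorm : deltaCoeff Q 1 = 1) (N : ℕ) (hN : 1 ≤ N) (k : ℤ) :
    HasLaurentSum
        (fun l : ℕ => ((Ring.choose ((N : ℤ) + k - 1) (N + l - 1) : ℤ) : ULaurent N) *
          (constU (hFun Q N (l : ℤ)) *
            inU (pSeq Q (k - (l : ℤ)))))
        (addU (hFun Q N k)) ∧
      HasLaurentSum
        (fun l : ℕ => ((Ring.choose ((N : ℤ) + k - 1) (N + l - 1) : ℤ) : ULaurent N) *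
          (constU (hStarFun Q N (l : ℤ)) *
            inU (pSeq Q (k - (l : ℤ)))))
        (addU (hStarFun Q N k)) ∧
      HasLaurentSum
        (fun l : ℕ => ((Ring.choose ((N : ℤ) + k - 1) (N + l - 1) : ℤ) : ULaurent N) *
          (constU (hFun Q N (l : ℤ)) *
            inU (pStarSeq Q (k - (l : ℤ)))))
        (addU (hStarFun Q N k)) := by
  obtain ⟨n, rfl⟩ : ∃ n, N = n + 1 := ⟨N - 1, by omega⟩
  have hp := hQ.isMonicSeq_pSeq hnorm
  have hps := hQ.isMonicSeq_pStarSeq hnorm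
  have hdvd : ∀ l : ℕ, PowerSeries.X ^ l ∣ ((l.factorial : ℂ)⁻¹ • symb Q ^ l) := fun l =>
    X_pow_dvd_smul _ (hQ.X_pow_dvd_symb_pow l)
  have hdvd' : ∀ l : ℕ, PowerSeries.X ^ l ∣ ((l.factorial : ℂ)⁻¹ • (symb Q ^ l * symb' Q)) :=
    fun l => X_pow_dvd_smul _ ((hQ.X_pow_dvd_symb_pow l).mul_right _)
  have ht : ∀ l : ℕ, hFun Q (n + 1) l * altern xj (fun j : Fin (n + 1) => xj j ^ n)
      = altern xj (fun j => inVar j (pSeq Q ((n + l : ℕ) : ℤ))) := fun l => by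
    rw [hFun, schur_mul hp, Nat.cast_add]
  have ht' : ∀ l : ℕ, hStarFun Q (n + 1) l * altern xj (fun j : Fin (n + 1) => xj j ^ n)
      = altern xj (fun j => inVar j (pStarSeq Q ((n + l : ℕ) : ℤ))) := fun l => by
    rw [hStarFun, schur_mul hps, Nat.cast_add]
  refine ⟨?_, ?_, ?_⟩
  · simp only [term_eq (hQ.psAct_symb_pSeq hnorm)]
    exact hasLaurentSum_of_expansion hdvd (hQ.sum_pSeq hnorm) _ (schur_mul hp n k) ht
      fun l hl => altern_monicSeq_of_lt hp hl
  · simp only [term_eq (hQ.psAct_symb_pSeq hnorm)]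
    have h := hasLaurentSum_of_expansion hdvd' (hQ.sum_pStarSeq hnorm) _ (schur_mul hps n k) ht'
      fun l hl => altern_monicSeq_of_lt hps hl
    -- The factor `q'(D)` acts first and replaces `p*_{n+k}` by `p_{n+k}`, which is why `p_{k-l}(u)`
    -- accompanies `h*_l`.
    simp only [← smul_mul_assoc, psAct_mul, hQ.psAct_symb'_pStarSeq hnorm] at h
    exact h
  · simp only [term_eq (hQ.psAct_symb_pStarSeq hnorm)]
    exact hasLaurentSum_of_expansion hdvd (hQ.sum_pSeq hnorm) _ (schur_mul hps n k) ht
      fun l hl => altern_monicSeq_of_lt hp hl
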